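/- Let $n\ge 1$, let $\mathbb H=\{z=(x,t): x\in\mathbb R^n,\ t>0\}\subset\mathbb R^{n+1}$, and write $|E|$ for the Lebesgue measure of $E$. Let $\{\Delta_j\}_{j\ge1}$ be a Whitney decomposition of $\mathbb H$: closed cubes with sides parallel to the coordinate axes such that $\bigcup_j\Delta_j=\mathbb H$, $\operatorname{diam}\Delta_j\asymp\operatorname{dist}(\Delta_j,\partial\mathbb H)$ uniformly in $j$, the interiors of the $\Delta_j$ are pairwise disjoint, and the concentric cubes $\Delta_j^*$, enlarged $5/4$ times, satisfy $\sum_j\chi_{\Delta_j^*}\le N$ on $\mathbb H$ for some constant $N$. For $0<p<\infty$ and $\alpha>-1$ let $A(p,\alpha)$ be the space of all (real- or complex-valued) harmonic functions $f$ on $\mathbb H$ with $$\|f\|_{A(p,\alpha)}=\Big(\int_{\mathbb H}|f(x,t)|^p\,t^\alpha\,dx\,dt\Big)^{1/p}<\infty .$$ For a positive Borel measure $\mu$ on $\mathbb H$ and $0<p,q<\infty$ let $K^p_q(\mu)$ be the space of all harmonic functions $f$ on $\mathbb H$ with $$\|f\|_{K^p_q(\mu)}=\Big(\sum_{k=-\infty}^{\infty}\Big(\int_{H_k}|f|^p\,d\mu\Big)^{q/p}\Big)^{1/q}<\infty,\qquad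 H_k=\mathbb R^n\times[2^{-k-1},2^{-k}).$$ **Theorem 8.** Let $\alpha>-1$, $0<p\le q<\infty$, and let $\mu$ be a positive Borel measure on $\mathbb H$. Then the following two conditions are equivalent. 1. $A(p,\alpha)\hookrightarrow K^p_q(\mu)$, that is, $A(p,\alpha)\subset K^p_q(\mu)$ and there is a constant $C<\infty$ such that $\|f\|_{K^p_q(\mu)}\le C\|f\|_{A(p,\alpha)}$ for all $f\in A(p,\alpha)$. 2. There is a constant $C<\infty$ such that $$\mu(\Delta_j)\le C\,|\Delta_j|^{1+\frac{\alpha}{n+1}},\qquad j\ge1 .$$ -/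

import Mathlib

open MeasureTheory
open scoped ENNReal NNReal

noncomputable section

namespace HarmonicHerz

/-- The Euclidean space `ℝ^{n+1}`; a point is `z = (x, t)` with `t` the last coordinate. -/
abbrev Space (n : ℕ) : Type := EuclideanSpace ℝ (Fin (n + 1))

/-- The last coordinate `t` of the point `z = (x, t)`. -/
def height {n : ℕ} (z : Space n) : ℝ := z (Fin.last n)

/-- The upper half space `ℍ = {(x, t) : x ∈ ℝ^n, t > 0}`. -/
def upperHalfSpace (n : ℕ) : Set (Space n) := {z | 0 < height z}

/-- The measure `dm_α(z) = t^α dx dt` on the upper half space. -/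
def weightedMeasure (n : ℕ) (α : ℝ) : Measure (Space n) :=
  (volume.restrict (upperHalfSpace n)).withDensity fun z => ENNReal.ofReal (height z ^ α)

/-- The dyadic horizontal strip `H_k = ℝ^n × [2^{-(k+1)}, 2^{-k})`, `k ∈ ℤ`. -/
def strip (n : ℕ) (k : ℤ) : Set (Space n) :=
  {z | (2 : ℝ) ^ (-(k + 1)) ≤ height z ∧ height z < (2 : ℝ) ^ (-k)}

/-- The closed cube with sides parallel to the coordinate axes, with center `c` and
side length `s`. -/
def cube {n : ℕ} (c : Space n) (s : ℝ) : Set (Space n) := {z | ∀ i, |z i - c i| ≤ s / 2}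

/-- The distance `inf {|a - b| : a ∈ A, b ∈ B}` between two sets. -/
def setDist {n : ℕ} (A B : Set (Space n)) : ℝ := sInf (Set.image2 dist A B)

/-- The closed cubes `Δ_j` with centers `ζ j` and side lengths `ℓ j` form a Whitney decomposition
of the upper half space. -/
structure IsWhitneyDecomposition {n : ℕ} (ζ : ℕ → Space n) (ℓ : ℕ → ℝ) : Prop where
  /-- the cubes are not degenerate -/
  side_pos : ∀ j, 0 < ℓ j
  /-- the cubes fill the upper half space -/
  iUnion_eq : ⋃ j, cube (ζ j) (ℓ j) = upperHalfSpace n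
  /-- the diameters are comparable to the distances to the boundary -/
  diam_comparable : ∃ c C : ℝ, 0 < c ∧ 0 < C ∧ ∀ j,
    c * setDist (cube (ζ j) (ℓ j)) (frontier (upperHalfSpace n)) ≤
        Metric.diam (cube (ζ j) (ℓ j)) ∧
      Metric.diam (cube (ζ j) (ℓ j)) ≤
        C * setDist (cube (ζ j) (ℓ j)) (frontier (upperHalfSpace n))
  /-- the interiors are pairwise disjoint -/
  interior_disjoint : Pairwise fun i j =>
    Disjoint (interior (cube (ζ i) (ℓ i))) (interior (cube (ζ j) (ℓ j)))
  /-- the concentric cubes enlarged `5/4` times have bounded overlap -/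
  finite_overlap : ∃ C : ℝ≥0, ∀ z ∈ upperHalfSpace n,
    ∑' j, (cube (ζ j) (5 / 4 * ℓ j)).indicator (fun _ => (1 : ℝ≥0∞)) z ≤ C

section Spaces

variable {n : ℕ} {𝕜 : Type*} [RCLike 𝕜]

/-- The (quasi-)norm `(∫_ℍ |f|^p dm_α)^{1/p}`, as an extended number. -/
def bergmanNorm (p α : ℝ) (f : Space n → 𝕜) : ℝ≥0∞ :=
  (∫⁻ z, ‖f z‖ₑ ^ p ∂(weightedMeasure n α)) ^ (1 / p)

/-- The weighted harmonic Bergman space `A(p, α)`. Functions on the upper half space are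
represented by functions on the whole space; their values elsewhere play no role. -/
def bergmanSpace (n : ℕ) (𝕜 : Type*) [RCLike 𝕜] (p α : ℝ) : Set (Space n → 𝕜) :=
  {f | InnerProductSpace.HarmonicOnNhd f (upperHalfSpace n) ∧ bergmanNorm p α f < ∞}

/-- The (quasi-)norm `(∑_{k ∈ ℤ} (∫_{H_k} |f|^p dμ)^{q/p})^{1/q}`, as an extended number. -/
def herzNorm (p q : ℝ) (μ : Measure (Space n)) (f : Space n → 𝕜) : ℝ≥0∞ :=
  (∑' k : ℤ, (∫⁻ z in strip n k, ‖f z‖ₑ ^ p ∂μ) ^ (q / p)) ^ (1 / q)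

/-- The harmonic Herz type space `K^p_q(μ)`. -/
def herzSpace (n : ℕ) (𝕜 : Type*) [RCLike 𝕜] (p q : ℝ) (μ : Measure (Space n)) :
    Set (Space n → 𝕜) :=
  {f | InnerProductSpace.HarmonicOnNhd f (upperHalfSpace n) ∧ herzNorm p q μ f < ∞}

/-- The continuous embedding `A(p, α) ↪ K^p_q(μ)`: the first space is contained in the second,
and the inclusion is bounded. -/
def BergmanEmbedsHerz (n : ℕ) (𝕜 : Type*) [RCLike 𝕜] (p q α : ℝ) (μ : Measure (Space n)) :
    Prop :=
  bergmanSpace n 𝕜 p α ⊆ herzSpace n 𝕜 p q μ ∧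
    ∃ C : ℝ≥0, ∀ f ∈ bergmanSpace n 𝕜 p α, herzNorm p q μ f ≤ C * bergmanNorm p α f

end Spaces

end HarmonicHerz

end

/-! Sufficiency rests on a local estimate: for every `p > 0`, the value `‖f z‖ ^ p` of a harmonic
function is at most a constant times the mean of `‖f‖ ^ p` over a ball about `z`
(`exists_enorm_rpow_le_lintegral_closedBall`). For `z` in a Whitney cube, a ball of radius
comparable to the side stays in the enlarged cube, where the weight is comparable to a power of the
side. Multiplying by the measure of the cube and summing with bounded overlap gives `∫ ‖f‖ ^ p dμ ≤
K ∫ ‖f‖ ^ p dm_α` (`IsWhitneyDecomposition.exists_lintegral_le`). The Herz norm is smaller still,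
because the sequence space `ℓ^1` lies in `ℓ^(q/p)` when `p ≤ q`.

Necessity is a test on one function per cube. A harmonic function with its pole below the boundary,
at depth comparable to the side of the cube, can decay as fast as desired: take the Kelvin transform
of the real part of a power of the null form `t + i x₁` (`harmonicAt_kelvinPow`). After scaling it
is bounded below on the cube, and the `p`-th power of its norm is at most a constant times `ℓ ^ (n +
1 + α)`. Since a Whitney cube meets a bounded number of dyadic strips, the embedding then bounds the
measure of the cube. -/

/-! ### A weighted mean value property of harmonic functions. -/

open Topology in
lemma hasDerivAt_max_zero_sq (x : ℝ) :
    HasDerivAt (fun y : ℝ => max 0 y ^ 2) (2 * max 0 x) x := by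
  rcases lt_trichotomy x 0 with hx | rfl | hx
  · have : (fun y : ℝ => max 0 y ^ 2) =ᶠ[𝓝 x] fun _ => 0 := by
      filter_upwards [gt_mem_nhds hx] with y hy
      simp [max_eq_left hy.le]
    rw [max_eq_left hx.le, mul_zero]
    exact (hasDerivAt_const x (0 : ℝ)).congr_of_eventuallyEq this
  · rw [hasDerivAt_iff_isLittleO_nhds_zero]
    simp only [zero_add, max_self, mul_zero, smul_zero, sub_zero, ne_eq, OfNat.ofNat_ne_zero,
      not_false_eq_true, zero_pow]
    refine Asymptotics.IsBigO.trans_isLittleO (g := fun h : ℝ => h ^ 2) ?_ ?_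
    · refine Asymptotics.IsBigO.of_bound 1 (Filter.Eventually.of_forall fun h => ?_)
      rw [one_mul, norm_pow, norm_pow]
      gcongr
      rw [Real.norm_eq_abs, Real.norm_eq_abs, abs_of_nonneg (le_max_left 0 h)]
      exact max_le (abs_nonneg h) (le_abs_self h)
    · simpa using Asymptotics.isLittleO_pow_id (𝕜 := ℝ) one_lt_two
  · have : (fun y : ℝ => max 0 y ^ 2) =ᶠ[𝓝 x] fun y => y ^ 2 := by
      filter_upwards [lt_mem_nhds hx] with y hy
      simp [max_eq_right hy.le]
    rw [max_eq_right hx.le]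
    simpa using (hasDerivAt_pow 2 x).congr_of_eventuallyEq this

section MeanValue

open InnerProductSpace

variable {E : Type*} [NormedAddCommGroup E]

/-- The truncated paraboloid `max 0 (1 - ‖z‖²)`, supported in the closed unit ball. -/
def paraboloid (z : E) : ℝ := max 0 (1 - ‖z‖ ^ 2)

lemma paraboloid_nonneg (z : E) : 0 ≤ paraboloid z := le_max_left _ _

lemma paraboloid_le_one (z : E) : paraboloid z ≤ 1 :=
  max_le zero_le_one (by nlinarith [sq_nonneg ‖z‖])

lemma continuous_paraboloid : Continuous (paraboloid : E → ℝ) := by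
  unfold paraboloid; fun_prop

lemma paraboloid_eq_zero {z : E} (hz : 1 ≤ ‖z‖) : paraboloid z = 0 :=
  max_eq_left (by nlinarith)

lemma tsupport_paraboloid_subset :
    tsupport (paraboloid : E → ℝ) ⊆ Metric.closedBall 0 1 := by
  refine closure_minimal (fun z hz => ?_) Metric.isClosed_closedBall
  by_contra h
  rw [mem_closedBall_zero_iff, not_le] at h
  exact hz (paraboloid_eq_zero h.le)

variable [InnerProductSpace ℝ E]

/-- The choice of weight comes from this formula: squaring removes the kink on the unit sphere, and
the field `paraboloid z • z` becomes `-1/4` times the gradient of a compactly supported function. -/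
lemma hasFDerivAt_paraboloid_sq (z : E) :
    HasFDerivAt (fun y : E => paraboloid y ^ 2) ((-4 * paraboloid z) • innerSL ℝ z) z := by
  have h1 : HasFDerivAt (fun y : E => 1 - ‖y‖ ^ 2) (-(2 • innerSL ℝ z)) z :=
    (hasStrictFDerivAt_norm_sq z).hasFDerivAt.const_sub 1
  refine ((hasDerivAt_max_zero_sq (1 - ‖z‖ ^ 2)).comp_hasFDerivAt z h1).congr_fderiv ?_
  ext v
  simp [paraboloid]
  ring

variable [FiniteDimensional ℝ E]

lemma hasCompactSupport_paraboloid : HasCompactSupport (paraboloid : E → ℝ) :=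
  HasCompactSupport.of_support_subset_isCompact (isCompact_closedBall 0 1)
    ((subset_tsupport _).trans tsupport_paraboloid_subset)

variable [MeasurableSpace E] [BorelSpace E]
  {F : Type*} [NormedAddCommGroup F] [NormedSpace ℝ F]

lemma integrable_paraboloid_smul {g : E → F} (hg : Continuous g) :
    Integrable (fun z => paraboloid z • g z) :=
  (continuous_paraboloid.smul hg).integrable_of_hasCompactSupport
    hasCompactSupport_paraboloid.smul_right

lemma integral_paraboloid_pos : 0 < ∫ z : E, paraboloid z := by
  refine continuous_paraboloid.integral_pos_of_hasCompactSupport_nonneg_nonzero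
    hasCompactSupport_paraboloid (fun z => paraboloid_nonneg z) (x := 0) ?_
  simp [paraboloid]

-- Because `paraboloid z • z` is a gradient, integration by parts in each coordinate turns the
-- radial derivative into `s` times the Laplacian of `f`, integrated against the squared weight.
-- That weight vanishes outside the unit ball, and the Laplacian vanishes on the part that remains.
open Laplacian in
lemma integral_paraboloid_smul_fderiv_eq_zero [CompleteSpace F] {f : E → F}
    (hf : ContDiff ℝ 2 f) {c : E} {s : ℝ}
    (h : ∀ z ∈ Metric.closedBall (0 : E) 1, (Δ f) (c + s • z) = 0) :
    ∫ z, paraboloid z • fderiv ℝ f (c + s • z) z = 0 := by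
  let b := stdOrthonormalBasis ℝ E
  have hd : ContDiff ℝ 1 (fderiv ℝ f) := hf.fderiv_right (by norm_num)
  have hd2 : Continuous (fderiv ℝ (fderiv ℝ f)) := hd.continuous_fderiv (by norm_num)
  have hdc := hd.continuous
  have hline (i) (z : E) : HasFDerivAt (fun z => fderiv ℝ f (c + s • z) (b i))
      ((ContinuousLinearMap.apply ℝ F (b i)).comp
        ((fderiv ℝ (fderiv ℝ f) (c + s • z)).comp (s • ContinuousLinearMap.id ℝ E))) z := by
    have h1 : HasFDerivAt (fun z : E => c + s • z) (s • ContinuousLinearMap.id ℝ E) z :=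
      ((hasFDerivAt_id z).const_smul s).const_add c
    have h2 := ((hd.differentiable (by norm_num)) (c + s • z)).hasFDerivAt.comp z h1
    exact (ContinuousLinearMap.apply ℝ F (b i)).hasFDerivAt.comp z h2
  have hsq : HasCompactSupport (fun z : E => paraboloid z ^ 2) := by
    simp only [sq]
    exact hasCompactSupport_paraboloid.mul_left
  have key (i) : ∫ z, (paraboloid z ^ 2) • (s • fderiv ℝ (fderiv ℝ f) (c + s • z) (b i) (b i))
      = - ∫ z, (-4 * paraboloid z * inner ℝ z (b i)) • fderiv ℝ f (c + s • z) (b i) := by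
    have := integral_bilinear_hasFDerivAt_right_eq_neg_left_of_integrable (μ := (volume : Measure E))
      (B := ContinuousLinearMap.lsmul ℝ ℝ) (v := b i)
      (f := fun z : E => paraboloid z ^ 2) (g := fun z => fderiv ℝ f (c + s • z) (b i))
      (f' := fun z => (-4 * paraboloid z) • innerSL ℝ z) (g' := fun z =>
        ((ContinuousLinearMap.apply ℝ F (b i)).comp
        ((fderiv ℝ (fderiv ℝ f) (c + s • z)).comp (s • ContinuousLinearMap.id ℝ E))))
      ?_ ?_ ?_ (fun z _ => hasFDerivAt_paraboloid_sq z) (fun z _ => hline i z)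
    · simpa [smul_comm s] using this
    · have := integrable_paraboloid_smul (E := E)
        (g := fun z => (-4 * inner ℝ z (b i)) • fderiv ℝ f (c + s • z) (b i)) (by fun_prop)
      refine this.congr (Filter.Eventually.of_forall fun z => ?_)
      simp [smul_smul]; ring_nf
    · refine Continuous.integrable_of_hasCompactSupport ?_ ?_
      · have := continuous_paraboloid (E := E)
        simp only [ContinuousLinearMap.lsmul_apply]
        simp
        fun_prop
      · exact hsq.smul_right
    · refine Continuous.integrable_of_hasCompactSupport ?_ ?_
      · have := continuous_paraboloid (E := E)
        simp only [ContinuousLinearMap.lsmul_apply]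
        fun_prop
      · exact hsq.smul_right
  have hsum : ∑ i, ∫ z, (paraboloid z ^ 2) •
      (s • fderiv ℝ (fderiv ℝ f) (c + s • z) (b i) (b i)) = 0 := by
    rw [← integral_finsetSum]
    · rw [← integral_zero E F]
      refine integral_congr_ae (Filter.Eventually.of_forall fun z => ?_)
      by_cases hz : z ∈ Metric.closedBall (0 : E) 1
      · have := h z hz
        rw [laplacian_eq_iteratedFDeriv_orthonormalBasis f b] at this
        simp only [iteratedFDeriv_two_apply] at this
        simp only [← Finset.smul_sum]
        simp at this
        simp [this]
      · rw [mem_closedBall_zero_iff, not_le] at hz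
        simp [paraboloid_eq_zero hz.le]
    · intro i _
      refine Continuous.integrable_of_hasCompactSupport ?_ hsq.smul_right
      have := continuous_paraboloid (E := E)
      fun_prop
  simp only [key, Finset.sum_neg_distrib, neg_eq_zero] at hsum
  rw [← integral_finsetSum] at hsum
  · have h4 : ∫ z, (-4 : ℝ) • (paraboloid z • fderiv ℝ f (c + s • z) z) = 0 := by
      rw [← hsum]
      refine integral_congr_ae (Filter.Eventually.of_forall fun z => ?_)
      have hz : z = ∑ i, inner ℝ z (b i) • b i := by
        conv_lhs => rw [← b.sum_repr z]
        simp [b.repr_apply_apply, real_inner_comm]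
      have : fderiv ℝ f (c + s • z) z = ∑ i, inner ℝ z (b i) • fderiv ℝ f (c + s • z) (b i) := by
        conv_lhs => rw [hz, map_sum]
        simp only [map_smul, ← hz]
      simp only [this, Finset.smul_sum, smul_smul, mul_assoc]
    rw [integral_smul] at h4
    exact (smul_eq_zero.1 h4).resolve_left (by norm_num)
  · intro i _
    have := integrable_paraboloid_smul (E := E)
        (g := fun z => (-4 * inner ℝ z (b i)) • fderiv ℝ f (c + s • z) (b i)) (by fun_prop)
    refine this.congr (Filter.Eventually.of_forall fun z => ?_)
    simp [smul_smul]; ring_nf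

lemma hasDerivAt_integral_paraboloid_smul {f : E → F} (hf : ContDiff ℝ 1 f) (c : E) (s : ℝ) :
    HasDerivAt (fun s : ℝ => ∫ z, paraboloid z • f (c + s • z))
      (∫ z, paraboloid z • fderiv ℝ f (c + s • z) z) s := by
  have hfc := hf.continuous
  have hdc : Continuous (fderiv ℝ f) := hf.continuous_fderiv (by norm_num)
  -- The weight is zero off the unit ball, so a bound on a compact set of pairs (scale, point) gives
  -- an integrable dominating function.
  obtain ⟨K, hK⟩ : ∃ K, ∀ x ∈ (Metric.closedBall s 1 ×ˢ Metric.closedBall (0 : E) 1),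
      ‖fderiv ℝ f (c + x.1 • x.2) x.2‖ ≤ K :=
    ((isCompact_closedBall s 1).prod (isCompact_closedBall (0 : E) 1)).exists_bound_of_continuousOn
      (by fun_prop)
  refine (hasDerivAt_integral_of_dominated_loc_of_deriv_le (μ := volume)
    (F := fun (s : ℝ) (z : E) => paraboloid z • f (c + s • z))
    (F' := fun (s : ℝ) (z : E) => paraboloid z • fderiv ℝ f (c + s • z) z)
    (bound := fun z => paraboloid z • K)
    (Metric.ball_mem_nhds s one_pos) ?_ ?_ ?_ ?_ ?_ ?_).2
  · exact Filter.Eventually.of_forall fun t =>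
      (integrable_paraboloid_smul (by fun_prop)).aestronglyMeasurable
  · exact integrable_paraboloid_smul (by fun_prop)
  · exact (integrable_paraboloid_smul (by fun_prop)).aestronglyMeasurable
  · refine Filter.Eventually.of_forall fun z t ht => ?_
    rw [norm_smul, Real.norm_of_nonneg (paraboloid_nonneg z), smul_eq_mul]
    by_cases hz : z ∈ Metric.closedBall (0 : E) 1
    · exact mul_le_mul_of_nonneg_left (hK (t, z) ⟨Metric.ball_subset_closedBall ht, hz⟩)
        (paraboloid_nonneg z)
    · rw [mem_closedBall_zero_iff, not_le] at hz
      simp [paraboloid_eq_zero hz.le]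
  · exact integrable_paraboloid_smul continuous_const
  · refine Filter.Eventually.of_forall fun z t ht => ?_
    have h1 : HasDerivAt (fun t : ℝ => c + t • z) z t := by
      simpa using ((hasDerivAt_id t).smul_const z).const_add c
    exact ((hf.differentiable (by norm_num) (c + t • z)).hasFDerivAt.comp_hasDerivAt t h1).const_smul
      (paraboloid z)

open Laplacian in
/-- The mean value property with the paraboloid weight, for globally `C²` functions. -/
lemma ContDiff.integral_paraboloid_smul_eq [CompleteSpace F] {f : E → F} (hf : ContDiff ℝ 2 f)
    {c : E} {r : ℝ} (hr : 0 ≤ r) (h : ∀ z ∈ Metric.closedBall c r, (Δ f) z = 0) :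
    ∫ z, paraboloid z • f (c + r • z) = (∫ z : E, paraboloid z) • f c := by
  have hder (s : ℝ) := hasDerivAt_integral_paraboloid_smul (hf.of_le (by norm_num)) c s
  -- The weighted mean does not depend on the scale; compare the scales `r` and `0`.
  have := constant_of_has_deriv_right_zero (a := 0) (b := r)
    (f := fun s : ℝ => ∫ z, paraboloid z • f (c + s • z))
    (fun s _ => (hder s).continuousAt.continuousWithinAt) (fun s hs => by
      have h0 : ∫ z, paraboloid z • fderiv ℝ f (c + s • z) z = 0 :=
        integral_paraboloid_smul_fderiv_eq_zero hf fun z hz => h _ <| by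
          rw [mem_closedBall_zero_iff] at hz
          rw [Metric.mem_closedBall, dist_self_add_left, norm_smul, Real.norm_of_nonneg hs.1]
          nlinarith [hs.1, hs.2]
      have := hder s
      rw [h0] at this
      exact this.hasDerivWithinAt) r ⟨hr, le_rfl⟩
  simp only [zero_smul, add_zero] at this
  rw [this, integral_smul_const]

/-- The mean value property of harmonic functions with the paraboloid weight. -/
lemma InnerProductSpace.HarmonicOnNhd.integral_paraboloid_smul_eq [CompleteSpace F] {f : E → F}
    {c : E} {r : ℝ} (hr : 0 ≤ r) (hf : HarmonicOnNhd f (Metric.closedBall c r)) :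
    ∫ z, paraboloid z • f (c + r • z) = (∫ z : E, paraboloid z) • f c := by
  obtain ⟨δ, hδ, hsub⟩ := (isCompact_closedBall c r).exists_cthickening_subset_open
    (isOpen_setOfPred_harmonicAt f) hf
  rw [cthickening_closedBall hδ.le hr] at hsub
  -- The cutoff is 1 on a neighbourhood of the closed ball, so it changes neither `f` nor its
  -- Laplacian there, and it is supported where `f` is still harmonic. The global version then
  -- applies.
  let χ : ContDiffBump c := ⟨r + δ / 3, r + δ / 2, by positivity, by linarith⟩
  have hg : ContDiff ℝ 2 (fun z => χ z • f z) := by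
    rw [contDiff_iff_contDiffAt]
    intro z
    by_cases hz : z ∈ Metric.closedBall c (δ + r)
    · exact χ.contDiff.contDiffAt.smul (hsub hz).1
    · have : (fun z => χ z • f z) =ᶠ[nhds z] fun _ => 0 := by
        have : z ∈ (tsupport χ)ᶜ := fun h => hz <| by
          rw [χ.tsupport_eq] at h
          exact Metric.closedBall_subset_closedBall (by simp [χ]; linarith) h
        filter_upwards [(isClosed_tsupport χ).isOpen_compl.mem_nhds this] with y hy
        rw [image_eq_zero_of_notMem_tsupport hy, zero_smul]
      exact contDiffAt_const.congr_of_eventuallyEq this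
  have heq (z : E) (hz : z ∈ Metric.closedBall c r) : (fun z => χ z • f z) =ᶠ[nhds z] f := by
    have : z ∈ Metric.ball c (r + δ / 3) :=
      Metric.closedBall_subset_ball (by linarith) hz
    filter_upwards [Metric.isOpen_ball.mem_nhds this] with y hy
    rw [χ.one_of_mem_closedBall (Metric.ball_subset_closedBall hy), one_smul]
  have := hg.integral_paraboloid_smul_eq hr (c := c) fun z hz => by
    rw [(laplacian_congr_nhds (heq z hz)).self_of_nhds, (hf z hz).2.self_of_nhds, Pi.zero_apply]
  have hc : χ c • f c = f c := (heq c (Metric.mem_closedBall_self hr)).self_of_nhds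
  rw [hc] at this
  rw [← this]
  refine integral_congr_ae (Filter.Eventually.of_forall fun z => ?_)
  by_cases hz : z ∈ Metric.closedBall (0 : E) 1
  · rw [mem_closedBall_zero_iff] at hz
    have : c + r • z ∈ Metric.closedBall c r := by
      rw [Metric.mem_closedBall, dist_self_add_left, norm_smul, Real.norm_of_nonneg hr]
      nlinarith
    exact congrArg (paraboloid z • ·) (heq _ this).self_of_nhds.symm
  · rw [mem_closedBall_zero_iff, not_le] at hz
    simp [paraboloid_eq_zero hz.le]

end MeanValue

/-! ### Local `L^p` estimates for all `p > 0`. -/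

section LocalEstimate

open InnerProductSpace Module

/-- An absorption step: finiteness of `a` allows cancelling `a ^ (1 - p)`. -/
lemma ENNReal.rpow_le_of_le_mul_rpow_one_sub {a b : ℝ≥0∞} {p : ℝ} (ha : a ≠ ∞) (hp : 0 < p)
    (h : a ≤ b * a ^ (1 - p)) : a ^ p ≤ b := by
  rcases eq_or_ne a 0 with rfl | h0
  · simp [ENNReal.zero_rpow_of_pos hp]
  · have h1 : a ^ (1 - p) ≠ 0 := (ENNReal.rpow_pos (pos_iff_ne_zero.2 h0) ha).ne'
    have h2 : a ^ (1 - p) ≠ ∞ := ENNReal.rpow_ne_top_of_ne_zero h0 ha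
    have h3 : a ^ p * a ^ (1 - p) = a := by
      rw [← ENNReal.rpow_add _ _ h0 ha]; simp
    rw [← ENNReal.mul_le_mul_iff_left h1 h2, h3]
    exact h

/-- The maximum over a ball of `(r - ‖z - c‖) ^ s ‖f z‖`: a point at which `f` is comparable to
its maximum over a small ball. -/
lemma exists_norm_le_mul_norm_on_closedBall {E F : Type*} [NormedAddCommGroup E]
    [ProperSpace E] [NormedAddCommGroup F] {f : E → F} {c : E} {r s : ℝ} (hr : 0 < r)
    (hs : 0 < s) (hf : ContinuousOn f (Metric.closedBall c r)) (hc : f c ≠ 0) :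
    ∃ a ρ, 0 < ρ ∧ Metric.closedBall a ρ ⊆ Metric.closedBall c r ∧
      (∀ w ∈ Metric.closedBall a ρ, ‖f w‖ ≤ 2 ^ s * ‖f a‖) ∧
      ‖f c‖ * r ^ s ≤ ‖f a‖ * (2 * ρ) ^ s := by
  obtain ⟨a, ha, hmax⟩ := (isCompact_closedBall c r).exists_isMaxOn
    (Metric.nonempty_closedBall.2 hr.le) (f := fun z => ‖f z‖ * (r - dist z c) ^ s)
    (hf.norm.mul (ContinuousOn.rpow_const (by fun_prop) fun _ _ => Or.inr hs.le))
  have hca : ‖f c‖ * r ^ s ≤ ‖f a‖ * (r - dist a c) ^ s := by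
    simpa using hmax (Metric.mem_closedBall_self hr.le)
  rw [Metric.mem_closedBall] at ha
  have hlt : 0 < r - dist a c := by
    refine lt_of_le_of_ne (sub_nonneg.2 ha) fun h => ?_
    rw [← h, Real.zero_rpow hs.ne', mul_zero] at hca
    have : 0 < ‖f c‖ * r ^ s := by positivity
    linarith
  -- With half the gap to the sphere as radius, the gap shrinks by a factor of at most 2 on the
  -- small ball, so maximality costs a factor `2 ^ s`.
  refine ⟨a, (r - dist a c) / 2, by linarith,
    Metric.closedBall_subset_closedBall' (by linarith), fun w hw => ?_, ?_⟩
  · rw [Metric.mem_closedBall] at hw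
    have htri := dist_triangle w a c
    have hwc : (r - dist a c) / 2 ≤ r - dist w c := by linarith
    have hm : ‖f w‖ * (r - dist w c) ^ s ≤ ‖f a‖ * (r - dist a c) ^ s :=
      hmax (Metric.mem_closedBall.2 (by linarith))
    have h2 : r - dist a c = 2 * ((r - dist a c) / 2) := by ring
    have h3 : ‖f w‖ * ((r - dist a c) / 2) ^ s ≤ ‖f w‖ * (r - dist w c) ^ s := by gcongr
    have h4 : 0 < ((r - dist a c) / 2) ^ s := by positivity
    rw [h2, Real.mul_rpow zero_le_two (by linarith)] at hm
    refine le_of_mul_le_mul_right ?_ h4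
    linarith
  · rwa [mul_div_cancel₀ _ two_ne_zero]

variable {E : Type*} [NormedAddCommGroup E] [InnerProductSpace ℝ E] [FiniteDimensional ℝ E]
  [MeasurableSpace E] [BorelSpace E]

lemma lintegral_comp_add_smul (g : E → ℝ≥0∞) (c : E) {r : ℝ} (hr : 0 < r) :
    ∫⁻ z, g (c + r • z) = (ENNReal.ofReal (r ^ finrank ℝ E))⁻¹ * ∫⁻ z, g z := by
  have h1 : MeasurableEmbedding (fun z : E => r • z) :=
    (Homeomorph.smulOfNeZero r hr.ne').measurableEmbedding
  calc ∫⁻ z, g (c + r • z) = ∫⁻ z, g (c + z) ∂(Measure.map (fun z : E => r • z) volume) := by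
        rw [h1.lintegral_map]
    _ = _ := by
      rw [Measure.map_addHaar_smul _ hr.ne', lintegral_smul_measure,
        lintegral_add_left_eq_self (μ := volume) g c, smul_eq_mul,
        abs_of_pos (by positivity), ENNReal.ofReal_inv_of_pos (by positivity)]

variable {F : Type*} [NormedAddCommGroup F] [NormedSpace ℝ F] [CompleteSpace F]

variable (E) in
/-- The constant in the local `L¹` estimate for harmonic functions. -/
noncomputable def harmonicConst : ℝ≥0 := (∫ z : E, paraboloid z).toNNReal⁻¹

lemma InnerProductSpace.HarmonicOnNhd.enorm_le_lintegral {f : E → F} {c : E} {r : ℝ} (hr : 0 < r)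
    (hf : HarmonicOnNhd f (Metric.closedBall c r)) :
    ‖f c‖ₑ ≤ harmonicConst E * (ENNReal.ofReal (r ^ finrank ℝ E))⁻¹ *
      ∫⁻ z in Metric.closedBall c r, ‖f z‖ₑ := by
  have hpos := integral_paraboloid_pos (E := E)
  set a := ∫ z : E, paraboloid z
  have h1 : ENNReal.ofReal a * ‖f c‖ₑ ≤ (ENNReal.ofReal (r ^ finrank ℝ E))⁻¹ *
      ∫⁻ z in Metric.closedBall c r, ‖f z‖ₑ := by
    rw [← lintegral_indicator Metric.isClosed_closedBall.measurableSet,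
      ← lintegral_comp_add_smul _ c hr]
    calc ENNReal.ofReal a * ‖f c‖ₑ = ‖∫ z, paraboloid z • f (c + r • z)‖ₑ := by
          rw [hf.integral_paraboloid_smul_eq hr.le, enorm_smul, Real.enorm_of_nonneg hpos.le]
      _ ≤ ∫⁻ z, ‖paraboloid z • f (c + r • z)‖ₑ := enorm_integral_le_lintegral_enorm _
      _ ≤ _ := by
        refine lintegral_mono fun z => ?_
        by_cases hz : ‖z‖ ≤ 1
        · rw [Set.indicator_of_mem, enorm_smul]
          · refine mul_le_of_le_one_left' ?_
            rw [Real.enorm_of_nonneg (paraboloid_nonneg z)]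
            exact ENNReal.ofReal_le_one.2 (paraboloid_le_one z)
          · rw [Metric.mem_closedBall, dist_self_add_left, norm_smul, Real.norm_of_nonneg hr.le]
            nlinarith
        · simp [paraboloid_eq_zero (not_le.1 hz).le]
  have h2 : (harmonicConst E : ℝ≥0∞) = (ENNReal.ofReal a)⁻¹ := by
    rw [harmonicConst, ENNReal.coe_inv (by simpa using hpos)]
    rfl
  rw [h2, mul_assoc, ← ENNReal.div_eq_inv_mul, ENNReal.le_div_iff_mul_le, mul_comm]
  · exact h1
  · simp [hpos]
  · simp

lemma volume_closedBall_eq (c : E) {r : ℝ} (hr : 0 ≤ r) :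
    volume (Metric.closedBall c r) =
      ENNReal.ofReal (r ^ finrank ℝ E) * volume (Metric.ball (0 : E) 1) :=
  Measure.addHaar_closedBall _ c hr

/-- Hölder's inequality applied to the `L¹` estimate; the powers of the radius combine to `r ^
(-d)`. -/
lemma InnerProductSpace.HarmonicOnNhd.enorm_rpow_le_lintegral_of_one_le {p : ℝ} (hp : 1 ≤ p)
    {f : E → F} {c : E} {r : ℝ} (hr : 0 < r) (hf : HarmonicOnNhd f (Metric.closedBall c r)) :
    ‖f c‖ₑ ^ p ≤ harmonicConst E ^ p * volume (Metric.ball (0 : E) 1) ^ (p - 1) *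
      (ENNReal.ofReal (r ^ finrank ℝ E))⁻¹ * ∫⁻ z in Metric.closedBall c r, ‖f z‖ₑ ^ p := by
  have hp0 : 0 < p := one_pos.trans_le hp
  have hmeas : AEStronglyMeasurable f (volume.restrict (Metric.closedBall c r)) :=
    hf.continuousOn.aestronglyMeasurable Metric.isClosed_closedBall.measurableSet
  set R := ENNReal.ofReal (r ^ finrank ℝ E)
  have hR0 : R ≠ 0 := by simpa [R] using by positivity
  have hR : R ≠ ∞ := ENNReal.ofReal_ne_top
  have hol := eLpNorm'_le_eLpNorm'_mul_rpow_measure_univ one_pos hp hmeas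
  simp only [eLpNorm', ENNReal.rpow_one, div_one,
    Measure.restrict_apply_univ] at hol
  rw [volume_closedBall_eq c hr.le] at hol
  set V := volume (Metric.ball (0 : E) 1)
  set I := ∫⁻ z in Metric.closedBall c r, ‖f z‖ₑ ^ p
  have h1 := ENNReal.rpow_le_rpow ((hf.enorm_le_lintegral hr).trans (mul_le_mul_right hol _)) hp0.le
  refine h1.trans_eq ?_
  rw [ENNReal.mul_rpow_of_nonneg _ _ hp0.le, ENNReal.mul_rpow_of_nonneg _ _ hp0.le,
    ENNReal.mul_rpow_of_nonneg _ _ hp0.le, ← ENNReal.rpow_mul, ← ENNReal.rpow_mul,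
    show (1 - 1 / p) * p = p - 1 by field_simp, show 1 / p * p = 1 by field_simp,
    ENNReal.rpow_one, ENNReal.mul_rpow_of_nonneg _ _ (by linarith)]
  have : R⁻¹ ^ p * R ^ (p - 1) = R⁻¹ := by
    rw [ENNReal.inv_rpow, ← ENNReal.rpow_neg, ← ENNReal.rpow_add _ _ hR0 hR]
    ring_nf
    rw [ENNReal.rpow_neg_one]
  calc _ = harmonicConst E ^ p * V ^ (p - 1) * (R⁻¹ ^ p * R ^ (p - 1)) * I := by ring
    _ = _ := by rw [this]

/-- Hölder is not available here. At a point `a` where `f` is nearly maximal on a small ball, write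
`‖f‖ = ‖f‖ ^ (1 - p) * ‖f‖ ^ p`, bound the first factor by a multiple of `‖f a‖ ^ (1 - p)`, and
absorb it on the left of the `L¹` estimate. The weighted maximality then carries the bound from `a`
back to the centre. -/
lemma InnerProductSpace.HarmonicOnNhd.enorm_rpow_le_lintegral_of_le_one {p : ℝ} (hp0 : 0 < p)
    (hp : p ≤ 1) [Nontrivial E] {f : E → F} {c : E} {r : ℝ} (hr : 0 < r)
    (hf : HarmonicOnNhd f (Metric.closedBall c r)) :
    ‖f c‖ₑ ^ p ≤ harmonicConst E * (2 ^ (finrank ℝ E / p : ℝ)) ^ (1 - p) * 2 ^ finrank ℝ E *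
      (ENNReal.ofReal (r ^ finrank ℝ E))⁻¹ * ∫⁻ z in Metric.closedBall c r, ‖f z‖ₑ ^ p := by
  rcases eq_or_ne (f c) 0 with h0 | h0
  · simp [h0, ENNReal.zero_rpow_of_pos hp0]
  have hd : (0 : ℝ) < finrank ℝ E := by exact_mod_cast finrank_pos
  -- The exponent `d / p` makes the `p`-th power of the weight scale like volume, so that `ρ`
  -- cancels at the end.
  obtain ⟨a, ρ, hρ, hsub, hle, hca⟩ := exists_norm_le_mul_norm_on_closedBall hr
    (div_pos hd hp0) hf.continuousOn h0
  set d := finrank ℝ E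
  set s : ℝ := d / p
  set I := ∫⁻ z in Metric.closedBall c r, ‖f z‖ₑ ^ p
  have h1 : ‖f a‖ₑ ≤ (harmonicConst E * (ENNReal.ofReal (ρ ^ d))⁻¹ * (2 ^ s) ^ (1 - p) * I) *
      ‖f a‖ₑ ^ (1 - p) := by
    refine ((hf.mono hsub).enorm_le_lintegral hρ).trans ?_
    have : ∫⁻ z in Metric.closedBall a ρ, ‖f z‖ₑ ≤
        (2 ^ s * ‖f a‖ₑ) ^ (1 - p) * I := by
      have hne : (2 ^ s * ‖f a‖ₑ) ^ (1 - p) ≠ ∞ :=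
        ENNReal.rpow_ne_top_of_nonneg (by linarith)
          (ENNReal.mul_ne_top (ENNReal.rpow_ne_top_of_nonneg (by positivity) (by simp)) (by simp))
      calc ∫⁻ z in Metric.closedBall a ρ, ‖f z‖ₑ
          ≤ ∫⁻ z in Metric.closedBall a ρ, (2 ^ s * ‖f a‖ₑ) ^ (1 - p) * ‖f z‖ₑ ^ p := by
            refine setLIntegral_mono' Metric.isClosed_closedBall.measurableSet fun z hz => ?_
            have h2 : ‖f z‖ₑ ≤ 2 ^ s * ‖f a‖ₑ := by
              have := ENNReal.ofReal_le_ofReal (hle z hz)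
              rw [ENNReal.ofReal_mul (by positivity), ofReal_norm, ofReal_norm,
                ← ENNReal.ofReal_rpow_of_pos two_pos] at this
              simpa using this
            calc ‖f z‖ₑ = ‖f z‖ₑ ^ (1 - p) * ‖f z‖ₑ ^ p := by
                  rw [← ENNReal.rpow_add_of_nonneg _ _ (by linarith) hp0.le]; simp
              _ ≤ _ := by gcongr
        _ = (2 ^ s * ‖f a‖ₑ) ^ (1 - p) * ∫⁻ z in Metric.closedBall a ρ, ‖f z‖ₑ ^ p :=
            lintegral_const_mul' _ _ hne
        _ ≤ _ := by gcongr; exact lintegral_mono_set hsub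
    calc _ ≤ harmonicConst E * (ENNReal.ofReal (ρ ^ d))⁻¹ * ((2 ^ s * ‖f a‖ₑ) ^ (1 - p) * I) := by
          gcongr
      _ = _ := by
        rw [ENNReal.mul_rpow_of_nonneg _ _ (by linarith : 0 ≤ 1 - p)]; ring
  have h2 := ENNReal.rpow_le_of_le_mul_rpow_one_sub (by simp) hp0 h1
  have h3 : ‖f c‖ₑ ^ p * ENNReal.ofReal (r ^ d) ≤
      ‖f a‖ₑ ^ p * (2 ^ d * ENNReal.ofReal (ρ ^ d)) := by
    have h4 := Real.rpow_le_rpow (by positivity) hca hp0.le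
    rw [Real.mul_rpow (by positivity) (by positivity), Real.mul_rpow (by positivity) (by positivity),
      ← Real.rpow_mul hr.le, ← Real.rpow_mul (by positivity), div_mul_cancel₀ _ hp0.ne',
      Real.rpow_natCast, Real.rpow_natCast, mul_pow] at h4
    have h5 := ENNReal.ofReal_le_ofReal h4
    rw [ENNReal.ofReal_mul (by positivity), ENNReal.ofReal_mul (by positivity),
      ENNReal.ofReal_mul (by positivity), ← ENNReal.ofReal_rpow_of_nonneg (by positivity) hp0.le,
      ← ENNReal.ofReal_rpow_of_nonneg (by positivity) hp0.le, ofReal_norm, ofReal_norm,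
      ENNReal.ofReal_pow zero_le_two] at h5
    simpa using h5
  have hR0 : ENNReal.ofReal (r ^ d) ≠ 0 := by simpa using by positivity
  have hρ0 : ENNReal.ofReal (ρ ^ d) ≠ 0 := by simpa using by positivity
  rw [← ENNReal.le_div_iff_mul_le (Or.inl hR0) (Or.inl ENNReal.ofReal_ne_top)] at h3
  refine h3.trans ?_
  rw [ENNReal.div_eq_inv_mul]
  calc _ ≤ (ENNReal.ofReal (r ^ d))⁻¹ * ((harmonicConst E * (ENNReal.ofReal (ρ ^ d))⁻¹ *
        (2 ^ s) ^ (1 - p) * I) * (2 ^ d * ENNReal.ofReal (ρ ^ d))) := by gcongr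
    _ = harmonicConst E * (2 ^ s) ^ (1 - p) * 2 ^ d * (ENNReal.ofReal (r ^ d))⁻¹ * I *
        ((ENNReal.ofReal (ρ ^ d))⁻¹ * ENNReal.ofReal (ρ ^ d)) := by ring
    _ = _ := by rw [ENNReal.inv_mul_cancel hρ0 ENNReal.ofReal_ne_top, mul_one]

/-- The local `L^p` estimate for harmonic functions, for every `p > 0`. -/
lemma exists_enorm_rpow_le_lintegral_closedBall (E F : Type*) [NormedAddCommGroup E]
    [InnerProductSpace ℝ E] [FiniteDimensional ℝ E] [MeasurableSpace E] [BorelSpace E]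
    [Nontrivial E] [NormedAddCommGroup F] [NormedSpace ℝ F] [CompleteSpace F]
    {p : ℝ} (hp : 0 < p) :
    ∃ K : ℝ≥0∞, K ≠ ∞ ∧ ∀ (f : E → F) (c : E) (r : ℝ), 0 < r →
      HarmonicOnNhd f (Metric.closedBall c r) →
      ‖f c‖ₑ ^ p ≤ K * (ENNReal.ofReal (r ^ finrank ℝ E))⁻¹ *
        ∫⁻ z in Metric.closedBall c r, ‖f z‖ₑ ^ p := by
  rcases le_total 1 p with h | h
  · refine ⟨_, ?_, fun f c r hr hf => hf.enorm_rpow_le_lintegral_of_one_le h hr⟩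
    exact ENNReal.mul_ne_top (ENNReal.rpow_ne_top_of_nonneg hp.le ENNReal.coe_ne_top)
      (ENNReal.rpow_ne_top_of_nonneg (by linarith) measure_ball_lt_top.ne)
  · refine ⟨_, ?_, fun f c r hr hf => hf.enorm_rpow_le_lintegral_of_le_one hp h hr⟩
    refine ENNReal.mul_ne_top (ENNReal.mul_ne_top ENNReal.coe_ne_top
      (ENNReal.rpow_ne_top_of_nonneg (by linarith) ?_)) (by simp)
    exact ENNReal.rpow_ne_top_of_nonneg (by positivity) (by simp)

end LocalEstimate

/-! ### Geometry of cubes, strips and the boundary. -/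

namespace HarmonicHerz

variable {n : ℕ}

lemma continuous_height : Continuous (height : Space n → ℝ) := by
  unfold height; fun_prop

lemma isOpen_upperHalfSpace (n : ℕ) : IsOpen (upperHalfSpace n) :=
  isOpen_lt continuous_const continuous_height

lemma abs_apply_sub_le_dist (z w : Space n) (i : Fin (n + 1)) : |z i - w i| ≤ dist z w := by
  rw [dist_eq_norm]
  exact PiLp.norm_apply_le (z - w) i

lemma isClosed_cube (c : Space n) (s : ℝ) : IsClosed (cube c s) := by
  have : cube c s = ⋂ i, {z : Space n | |z i - c i| ≤ s / 2} := by ext; simp [cube]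
  rw [this]
  exact isClosed_iInter fun i => isClosed_le (by fun_prop) (by fun_prop)

lemma norm_le_mul_of_forall_abs_le {x : Space n} {s : ℝ} (hs : 0 ≤ s) (h : ∀ i, |x i| ≤ s) :
    ‖x‖ ≤ (n + 1) * s := by
  rw [EuclideanSpace.norm_eq]
  refine Real.sqrt_le_iff.2 ⟨by positivity, ?_⟩
  calc ∑ i, ‖x i‖ ^ 2 ≤ ∑ _i : Fin (n + 1), s ^ 2 := by
        refine Finset.sum_le_sum fun i _ => ?_
        rw [Real.norm_eq_abs]
        exact pow_le_pow_left₀ (abs_nonneg _) (h i) 2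
    _ = (n + 1) * s ^ 2 := by simp
    _ ≤ ((n + 1) * s) ^ 2 := by
        rw [mul_pow]
        gcongr
        have : (0 : ℝ) ≤ n := n.cast_nonneg
        nlinarith

lemma dist_center_le_of_mem_cube {c z : Space n} {s : ℝ} (hs : 0 ≤ s) (hz : z ∈ cube c s) :
    dist z c ≤ (n + 1) * s := by
  rw [dist_eq_norm]
  refine norm_le_mul_of_forall_abs_le hs fun i => ?_
  have := hz i
  simp only [PiLp.sub_apply]
  linarith

lemma isBounded_cube (c : Space n) {s : ℝ} (hs : 0 ≤ s) : Bornology.IsBounded (cube c s) :=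
  Metric.isBounded_closedBall.subset fun _ hz => dist_center_le_of_mem_cube hs hz

lemma diam_cube_le (c : Space n) {s : ℝ} (hs : 0 ≤ s) :
    Metric.diam (cube c s) ≤ 2 * ((n + 1) * s) :=
  (Metric.diam_mono (fun _ hz => dist_center_le_of_mem_cube hs hz)
    Metric.isBounded_closedBall).trans (Metric.diam_closedBall (by positivity))

lemma le_diam_cube (c : Space n) {s : ℝ} (hs : 0 ≤ s) : s ≤ Metric.diam (cube c s) := by
  have hmem (ε : ℝ) (hε : |ε| ≤ s / 2) :
      c + EuclideanSpace.single (Fin.last n) ε ∈ cube c s := fun i => by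
    rcases eq_or_ne i (Fin.last n) with rfl | hi
    · simpa using hε
    · simpa [hi] using by linarith
  have h1 := Metric.dist_le_diam_of_mem (isBounded_cube c hs)
    (hmem (s / 2) (by rw [abs_of_nonneg (by linarith)]))
    (hmem (-(s / 2)) (by rw [abs_neg, abs_of_nonneg (by linarith)]))
  have h2 := abs_apply_sub_le_dist (c + EuclideanSpace.single (Fin.last n) (s / 2))
    (c + EuclideanSpace.single (Fin.last n) (-(s / 2))) (Fin.last n)
  simp only [PiLp.add_apply, PiLp.single_apply, if_true] at h2
  have h3 := (le_abs_self _).trans h2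
  linarith

/-- Enlarging by `5/4` adds `5s/8 - s/2 = s/8` on each side. -/
lemma closedBall_subset_cube {c z : Space n} {s r : ℝ} (hz : z ∈ cube c s) (hr : r ≤ s / 8) :
    Metric.closedBall z r ⊆ cube c (5 / 4 * s) := fun w hw i => by
  have h1 := (abs_apply_sub_le_dist w z i).trans (Metric.mem_closedBall.1 hw)
  have h2 := abs_sub_le (w i) (z i) (c i)
  have h3 := hz i
  linarith

lemma volume_cube (c : Space n) {s : ℝ} :
    volume (cube c s) = ENNReal.ofReal s ^ (n + 1) := by
  have h := EuclideanSpace.volume_preserving_symm_measurableEquiv_toLp (Fin (n + 1))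
  have : cube c s = (MeasurableEquiv.toLp 2 (Fin (n + 1) → ℝ)).symm ⁻¹'
      (Set.Icc (fun i => c i - s / 2) (fun i => c i + s / 2)) := by
    ext z
    simp only [cube, Set.mem_ofPred_eq, Set.mem_preimage, Set.mem_Icc, Pi.le_def, ← forall_and]
    refine forall_congr' fun i => ?_
    rw [abs_sub_le_iff]
    constructor
    · rintro ⟨h1, h2⟩
      exact ⟨by change _ ≤ z i; linarith, by change z i ≤ _; linarith⟩
    · rintro ⟨h1, h2⟩
      change _ ≤ z i at h1
      change z i ≤ _ at h2
      constructor <;> linarith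
  rw [this, h.measure_preimage measurableSet_Icc.nullMeasurableSet, Real.volume_Icc_pi]
  simp

lemma height_nonpos_of_mem_frontier {z : Space n} (hz : z ∈ frontier (upperHalfSpace n)) :
    height z ≤ 0 := by
  rw [(isOpen_upperHalfSpace n).frontier_eq] at hz
  exact not_lt.1 hz.2

lemma mem_frontier_of_height_eq_zero {z : Space n} (hz : height z = 0) :
    z ∈ frontier (upperHalfSpace n) := by
  rw [(isOpen_upperHalfSpace n).frontier_eq]
  refine ⟨Metric.mem_closure_iff.2 fun ε hε =>
    ⟨z + EuclideanSpace.single (Fin.last n) (ε / 2), ?_, ?_⟩, fun h => ?_⟩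
  · have : z (Fin.last n) = 0 := hz
    simpa [upperHalfSpace, height, this] using hε
  · rw [dist_self_add_right, PiLp.norm_single, Real.norm_of_nonneg (by linarith)]
    linarith
  · exact absurd hz (ne_of_gt h)

lemma sub_single_height_mem_frontier (z : Space n) :
    z - EuclideanSpace.single (Fin.last n) (height z) ∈ frontier (upperHalfSpace n) :=
  mem_frontier_of_height_eq_zero (by simp [height])

lemma setDist_frontier_le {A : Set (Space n)} {z : Space n} (hz : z ∈ A) (hh : 0 ≤ height z) :
    setDist A (frontier (upperHalfSpace n)) ≤ height z := by
  refine csInf_le ⟨0, ?_⟩ ⟨z, hz, _, sub_single_height_mem_frontier z, ?_⟩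
  · rintro _ ⟨a, -, b, -, rfl⟩
    exact dist_nonneg
  · rw [dist_self_sub_right, PiLp.norm_single, Real.norm_of_nonneg hh]

/-- Nonemptiness matters, since the real infimum of the empty set is 0. -/
lemma le_setDist_frontier {A : Set (Space n)} (hA : A.Nonempty) {δ : ℝ}
    (h : ∀ z ∈ A, δ ≤ height z) : δ ≤ setDist A (frontier (upperHalfSpace n)) := by
  obtain ⟨z, hz⟩ := hA
  refine le_csInf ⟨_, z, hz, _, sub_single_height_mem_frontier z, rfl⟩ ?_
  rintro _ ⟨a, ha, b, hb, rfl⟩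
  have h1 := (le_abs_self _).trans (abs_apply_sub_le_dist a b (Fin.last n))
  have h2 := height_nonpos_of_mem_frontier hb
  have h3 := h a ha
  simp only [height] at h2 h3
  linarith

/-- The heights in question span a fixed ratio `b / a`, hence a number of dyadic scales that does
not depend on `ℓ`. -/
lemma exists_zpow_finset {a b : ℝ} (ha : 0 < a) :
    ∃ M : ℕ, ∀ ℓ : ℝ, 0 < ℓ → ∃ S : Finset ℤ, S.card ≤ M ∧
      ∀ z : Space n, a * ℓ ≤ height z → height z ≤ b * ℓ → ∃ k ∈ S, z ∈ strip n k := by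
  obtain ⟨M, hM⟩ := pow_unbounded_of_one_lt (b / a) (one_lt_two : (1 : ℝ) < 2)
  rw [div_lt_iff₀ ha] at hM
  refine ⟨M + 1, fun ℓ hℓ => ?_⟩
  obtain ⟨N, hN1, hN2⟩ := exists_mem_Ico_zpow (mul_pos ha hℓ) (one_lt_two : (1 : ℝ) < 2)
  -- Heights in `[2 ^ m, 2 ^ (m + 1))` form the strip with index `-(m + 1)`.
  refine ⟨(Finset.Ico N (N + M + 1)).image fun k => -(k + 1), ?_, fun z hz1 hz2 => ?_⟩
  · refine Finset.card_image_le.trans ?_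
    rw [Int.card_Ico]
    omega
  · obtain ⟨m, hm1, hm2⟩ := exists_mem_Ico_zpow ((mul_pos ha hℓ).trans_le hz1)
      (one_lt_two : (1 : ℝ) < 2)
    refine ⟨-(m + 1), Finset.mem_image.2 ⟨m, ?_, rfl⟩, ?_⟩
    · rw [Finset.mem_Ico]
      constructor
      · have : (2 : ℝ) ^ N < 2 ^ (m + 1) := hN1.trans_lt (hz1.trans_lt hm2)
        have := (zpow_lt_zpow_iff_right₀ (one_lt_two : (1 : ℝ) < 2)).1 this
        omega
      · have : (2 : ℝ) ^ m < 2 ^ (N + M + 1) := by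
          calc (2 : ℝ) ^ m ≤ b * ℓ := hm1.trans hz2
            _ ≤ 2 ^ M * (a * ℓ) := by nlinarith
            _ < 2 ^ M * 2 ^ (N + 1) := by gcongr
            _ = 2 ^ (N + M + 1) := by
              rw [← zpow_natCast, ← zpow_add₀ two_ne_zero]
              ring_nf
        exact (zpow_lt_zpow_iff_right₀ (one_lt_two : (1 : ℝ) < 2)).1 this
    · constructor
      · simpa using hm1
      · simpa using hm2

variable {ζ : ℕ → Space n} {ℓ : ℕ → ℝ}

lemma IsWhitneyDecomposition.cube_subset (hΔ : IsWhitneyDecomposition ζ ℓ) (j : ℕ) :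
    cube (ζ j) (ℓ j) ⊆ upperHalfSpace n :=
  hΔ.iUnion_eq ▸ Set.subset_iUnion (fun j => cube (ζ j) (ℓ j)) j

lemma IsWhitneyDecomposition.exists_mul_le_height (hΔ : IsWhitneyDecomposition ζ ℓ) :
    ∃ a : ℝ, 0 < a ∧ ∀ j, ∀ z ∈ cube (ζ j) (ℓ j), a * ℓ j ≤ height z := by
  obtain ⟨_, C, _, hC, h⟩ := hΔ.diam_comparable
  refine ⟨C⁻¹, inv_pos.2 hC, fun j z hz => ?_⟩
  rw [inv_mul_le_iff₀ hC]
  have h1 := setDist_frontier_le hz (hΔ.cube_subset j hz).le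
  calc ℓ j ≤ _ := le_diam_cube (ζ j) (hΔ.side_pos j).le
    _ ≤ _ := (h j).2
    _ ≤ _ := by gcongr

/-- Heights within a cube differ by at most its side, so every height is at most the distance to the
boundary plus one side. -/
lemma IsWhitneyDecomposition.exists_height_le_mul (hΔ : IsWhitneyDecomposition ζ ℓ) :
    ∃ b : ℝ, 0 < b ∧ ∀ j, ∀ z ∈ cube (ζ j) (ℓ j), height z ≤ b * ℓ j := by
  obtain ⟨c, _, hc, _, h⟩ := hΔ.diam_comparable
  refine ⟨2 * (n + 1) / c + 1, by positivity, fun j z hz => ?_⟩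
  have h0 := hΔ.side_pos j
  have h1 : height z - ℓ j ≤ setDist (cube (ζ j) (ℓ j)) (frontier (upperHalfSpace n)) := by
    refine le_setDist_frontier ⟨z, hz⟩ fun w hw => ?_
    have h2 := hz (Fin.last n)
    have h3 := hw (Fin.last n)
    rw [abs_le] at h2 h3
    simp only [height]
    linarith
  have h2 := (h j).1.trans (diam_cube_le (ζ j) h0.le)
  rw [← le_div_iff₀' hc] at h2
  have : 2 * ((n + 1) * ℓ j) / c = 2 * (n + 1) / c * ℓ j := by ring
  linarith

end HarmonicHerz

/-! ### Sufficiency of the condition on the cubes. -/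

lemma ENNReal.tsum_rpow_le_rpow_tsum {ι : Type*} (a : ι → ℝ≥0∞) {r : ℝ} (hr : 1 ≤ r) :
    ∑' i, a i ^ r ≤ (∑' i, a i) ^ r := by
  have h (x : ℝ≥0∞) : x ^ r = x * x ^ (r - 1) := by
    conv_rhs => rw [← ENNReal.rpow_one x, ← ENNReal.rpow_mul, one_mul]
    rw [← ENNReal.rpow_add_of_nonneg _ _ zero_le_one (by linarith)]
    ring_nf
  calc ∑' i, a i ^ r ≤ ∑' i, a i * (∑' i, a i) ^ (r - 1) := by
        refine ENNReal.tsum_le_tsum fun i => ?_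
        rw [h]
        gcongr
        exact ENNReal.le_tsum i
    _ = _ := by rw [ENNReal.tsum_mul_right, ← h]

namespace HarmonicHerz

open InnerProductSpace

variable {n : ℕ}

lemma volume_cube_rpow (c : Space n) {s : ℝ} (hs : 0 < s) (α : ℝ) :
    volume (cube c s) ^ (1 + α / ((n : ℝ) + 1)) = ENNReal.ofReal (s ^ ((n : ℝ) + 1 + α)) := by
  have hn : (0 : ℝ) < n + 1 := by positivity
  rw [volume_cube, ← ENNReal.rpow_natCast, ← ENNReal.rpow_mul, ENNReal.ofReal_rpow_of_pos hs]
  congr 2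
  push_cast
  field_simp

/-- The sign of `α` decides which end of the interval gives the smaller power; the minimum covers
both. -/
lemma min_mul_rpow_le_rpow {a b s t : ℝ} (ha : 0 < a) (hs : 0 < s) (h1 : a * s ≤ t)
    (h2 : t ≤ b * s) (α : ℝ) : min (a ^ α) (b ^ α) * s ^ α ≤ t ^ α := by
  have hb : 0 < b := pos_of_mul_pos_left ((mul_pos ha hs).trans_le (h1.trans h2)) hs.le
  have h0 : 0 ≤ s ^ α := by positivity
  rcases le_total 0 α with h | h
  · calc _ ≤ a ^ α * s ^ α := by gcongr; exact min_le_left _ _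
      _ = (a * s) ^ α := (Real.mul_rpow ha.le hs.le).symm
      _ ≤ _ := Real.rpow_le_rpow (by positivity) h1 h
  · calc _ ≤ b ^ α * s ^ α := by gcongr; exact min_le_right _ _
      _ = (b * s) ^ α := (Real.mul_rpow hb.le hs.le).symm
      _ ≤ _ := Real.rpow_le_rpow_of_nonpos ((mul_pos ha hs).trans_le h1) h2 h

lemma smul_restrict_le_weightedMeasure_restrict {α : ℝ} {B : Set (Space n)}
    (hB : MeasurableSet B) (hBH : B ⊆ upperHalfSpace n) {κ : ℝ≥0∞}
    (h : ∀ z ∈ B, κ ≤ ENNReal.ofReal (height z ^ α)) :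
    κ • volume.restrict B ≤ (weightedMeasure n α).restrict B := by
  refine Measure.le_iff.2 fun s hs => ?_
  rw [Measure.smul_apply, Measure.restrict_apply hs, Measure.restrict_apply hs, weightedMeasure,
    withDensity_apply _ (hs.inter hB), smul_eq_mul, Measure.restrict_restrict (hs.inter hB),
    Set.inter_eq_left.2 (Set.inter_subset_right.trans hBH), ← setLIntegral_const]
  exact setLIntegral_mono' (hs.inter hB) fun z hz => h z hz.2

variable {ζ : ℕ → Space n} {ℓ : ℕ → ℝ}

/-- The values of a harmonic function on a Whitney cube are controlled by its weighted integral
over the enlarged cube. -/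
lemma IsWhitneyDecomposition.exists_enorm_rpow_le (hΔ : IsWhitneyDecomposition ζ ℓ)
    (𝕜 : Type*) [RCLike 𝕜] (α : ℝ) {p : ℝ} (hp : 0 < p) :
    ∃ K : ℝ≥0∞, K ≠ ∞ ∧ ∀ f : Space n → 𝕜, HarmonicOnNhd f (upperHalfSpace n) →
      ∀ j, ∀ z ∈ cube (ζ j) (ℓ j),
        ‖f z‖ₑ ^ p ≤ K * (ENNReal.ofReal (ℓ j ^ ((n : ℝ) + 1 + α)))⁻¹ *
          ∫⁻ w in cube (ζ j) (5 / 4 * ℓ j), ‖f w‖ₑ ^ p ∂(weightedMeasure n α) := by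
  obtain ⟨K, hK, hloc⟩ := exists_enorm_rpow_le_lintegral_closedBall (Space n) 𝕜 hp
  obtain ⟨a, ha, hlow⟩ := hΔ.exists_mul_le_height
  obtain ⟨b, hb, hup⟩ := hΔ.exists_height_le_mul
  -- The bound `1 / 8` keeps the ball in the enlarged cube; `a / 2` keeps it at height at least `a /
  -- 2 * ℓ j`, where the weight is under control.
  set κ := min (1 / 8) (a / 2) with hκ
  have hκ0 : 0 < κ := lt_min (by norm_num) (by linarith)
  set m := min ((a / 2) ^ α) ((b + 1) ^ α)
  have hm0 : 0 < m := lt_min (by positivity) (by positivity)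
  refine ⟨K * (ENNReal.ofReal (κ ^ (n + 1)))⁻¹ * (ENNReal.ofReal m)⁻¹, ?_, fun f hf j z hz => ?_⟩
  · refine ENNReal.mul_ne_top (ENNReal.mul_ne_top hK ?_) ?_
    · simpa using by positivity
    · simpa using hm0
  have hℓ := hΔ.side_pos j
  have hr0 : 0 < κ * ℓ j := by positivity
  have hball (w) (hw : w ∈ Metric.closedBall z (κ * ℓ j)) :
      a / 2 * ℓ j ≤ height w ∧ height w ≤ (b + 1) * ℓ j := by
    have h1 := (abs_apply_sub_le_dist w z (Fin.last n)).trans (Metric.mem_closedBall.1 hw)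
    have h2 := hlow j z hz
    have h3 := hup j z hz
    have h4 : κ * ℓ j ≤ a / 2 * ℓ j := by gcongr; exact min_le_right _ _
    have h5 : κ * ℓ j ≤ 1 / 8 * ℓ j := by gcongr; exact min_le_left _ _
    rw [abs_le] at h1
    simp only [height] at h2 h3 ⊢
    constructor <;> linarith
  have hsubH : Metric.closedBall z (κ * ℓ j) ⊆ upperHalfSpace n := fun w hw =>
    (by positivity : 0 < a / 2 * ℓ j).trans_le (hball w hw).1
  have hsub : Metric.closedBall z (κ * ℓ j) ⊆ cube (ζ j) (5 / 4 * ℓ j) :=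
    closedBall_subset_cube hz (by
      have : κ * ℓ j ≤ 1 / 8 * ℓ j := by gcongr; exact min_le_left _ _
      linarith)
  have hmeas := smul_restrict_le_weightedMeasure_restrict (α := α)
    Metric.isClosed_closedBall.measurableSet hsubH (κ := ENNReal.ofReal (m * ℓ j ^ α))
    fun w hw => ENNReal.ofReal_le_ofReal
      (min_mul_rpow_le_rpow (by positivity) hℓ (hball w hw).1 (hball w hw).2 α)
  have hint : ENNReal.ofReal (m * ℓ j ^ α) * ∫⁻ w in Metric.closedBall z (κ * ℓ j), ‖f w‖ₑ ^ p ≤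
      ∫⁻ w in cube (ζ j) (5 / 4 * ℓ j), ‖f w‖ₑ ^ p ∂(weightedMeasure n α) := by
    rw [← smul_eq_mul, ← lintegral_smul_measure]
    exact (lintegral_mono' hmeas le_rfl).trans (lintegral_mono_set hsub)
  have hm1 : ENNReal.ofReal (m * ℓ j ^ α) ≠ 0 := by simpa using by positivity
  rw [mul_comm, ← ENNReal.le_div_iff_mul_le (Or.inl hm1) (Or.inl ENNReal.ofReal_ne_top)] at hint
  refine (hloc f z _ hr0 (hf.mono hsubH)).trans ((mul_le_mul_right hint _).trans_eq ?_)
  rw [finrank_euclideanSpace_fin, ENNReal.div_eq_inv_mul, mul_pow,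
    ENNReal.ofReal_mul (by positivity), ENNReal.ofReal_mul (by positivity),
    Real.rpow_add hℓ, ENNReal.ofReal_mul (by positivity),
    ENNReal.mul_inv (Or.inr (by simp)) (Or.inl (by simp)),
    ENNReal.mul_inv (Or.inr (by simp)) (Or.inl (by simp)),
    ENNReal.mul_inv (Or.inr (by simp)) (Or.inl (by simp)),
    show (n : ℝ) + 1 = ((n + 1 : ℕ) : ℝ) by push_cast; rfl, Real.rpow_natCast]
  ring

lemma ae_mem_upperHalfSpace (α : ℝ) : ∀ᵐ z ∂(weightedMeasure n α), z ∈ upperHalfSpace n :=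
  (withDensity_absolutelyContinuous _ _).ae_le
    (ae_restrict_mem (isOpen_upperHalfSpace n).measurableSet)

/-- The function is arbitrary off the half space, but the weighted measure does not charge that set.
-/
lemma aemeasurable_enorm_rpow {𝕜 : Type*} [RCLike 𝕜] (α p : ℝ) {f : Space n → 𝕜}
    (hf : ContinuousOn f (upperHalfSpace n)) :
    AEMeasurable (fun z => ‖f z‖ₑ ^ p) (weightedMeasure n α) :=
  ((hf.aemeasurable (isOpen_upperHalfSpace n).measurableSet).mono_ac
    (withDensity_absolutelyContinuous _ _)).enorm.pow_const p

/-- The bounded overlap of the enlarged cubes allows summing integrals over them. -/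
lemma IsWhitneyDecomposition.exists_tsum_lintegral_le (hΔ : IsWhitneyDecomposition ζ ℓ) (α : ℝ) :
    ∃ N : ℝ≥0, ∀ g : Space n → ℝ≥0∞, AEMeasurable g (weightedMeasure n α) →
      ∑' j, ∫⁻ z in cube (ζ j) (5 / 4 * ℓ j), g z ∂(weightedMeasure n α) ≤
        N * ∫⁻ z, g z ∂(weightedMeasure n α) := by
  obtain ⟨N, hN⟩ := hΔ.finite_overlap
  refine ⟨N, fun g hg => ?_⟩
  have hm (j) : MeasurableSet (cube (ζ j) (5 / 4 * ℓ j)) := (isClosed_cube _ _).measurableSet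
  simp_rw [← lintegral_indicator (hm _)]
  rw [← lintegral_tsum fun j => hg.indicator (hm j), ← lintegral_const_mul'' _ hg]
  refine lintegral_mono_ae ?_
  filter_upwards [ae_mem_upperHalfSpace α] with z hz
  calc _ = (∑' j, (cube (ζ j) (5 / 4 * ℓ j)).indicator (fun _ => (1 : ℝ≥0∞)) z) * g z := by
        rw [← ENNReal.tsum_mul_right]
        refine tsum_congr fun j => ?_
        by_cases h : z ∈ cube (ζ j) (5 / 4 * ℓ j) <;> simp [h]
    _ ≤ _ := by gcongr; exact hN z hz

/-- The Carleson type estimate which follows from the condition on the Whitney cubes. -/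
lemma IsWhitneyDecomposition.exists_lintegral_le (hΔ : IsWhitneyDecomposition ζ ℓ)
    (𝕜 : Type*) [RCLike 𝕜] (α : ℝ) {p : ℝ} (hp : 0 < p) {μ : Measure (Space n)} {C : ℝ≥0}
    (hC : ∀ j, μ (cube (ζ j) (ℓ j)) ≤ C * ENNReal.ofReal (ℓ j ^ ((n : ℝ) + 1 + α))) :
    ∃ K : ℝ≥0∞, K ≠ ∞ ∧ ∀ f : Space n → 𝕜, HarmonicOnNhd f (upperHalfSpace n) →
      ∫⁻ z in upperHalfSpace n, ‖f z‖ₑ ^ p ∂μ ≤ K * ∫⁻ z, ‖f z‖ₑ ^ p ∂(weightedMeasure n α) := by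
  obtain ⟨K, hK, hloc⟩ := hΔ.exists_enorm_rpow_le 𝕜 α hp
  obtain ⟨N, hN⟩ := hΔ.exists_tsum_lintegral_le α
  refine ⟨C * K * N, ENNReal.mul_ne_top (ENNReal.mul_ne_top (by simp) hK) (by simp),
    fun f hf => ?_⟩
  calc ∫⁻ z in upperHalfSpace n, ‖f z‖ₑ ^ p ∂μ
      ≤ ∑' j, ∫⁻ z in cube (ζ j) (ℓ j), ‖f z‖ₑ ^ p ∂μ := by
        rw [← hΔ.iUnion_eq]
        exact lintegral_iUnion_le _ _
    _ ≤ ∑' j, C * K *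
          ∫⁻ z in cube (ζ j) (5 / 4 * ℓ j), ‖f z‖ₑ ^ p ∂(weightedMeasure n α) := by
        refine ENNReal.tsum_le_tsum fun j => ?_
        have hs0 : ENNReal.ofReal (ℓ j ^ ((n : ℝ) + 1 + α)) ≠ 0 := by
          have := hΔ.side_pos j
          simpa using by positivity
        set s := ENNReal.ofReal (ℓ j ^ ((n : ℝ) + 1 + α))
        set I := ∫⁻ z in cube (ζ j) (5 / 4 * ℓ j), ‖f z‖ₑ ^ p ∂(weightedMeasure n α)
        calc ∫⁻ z in cube (ζ j) (ℓ j), ‖f z‖ₑ ^ p ∂μ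
            ≤ ∫⁻ z in cube (ζ j) (ℓ j), K * s⁻¹ * I ∂μ :=
              setLIntegral_mono' (isClosed_cube _ _).measurableSet fun z hz => hloc f hf j z hz
          _ = K * s⁻¹ * I * μ (cube (ζ j) (ℓ j)) := setLIntegral_const _ _
          _ ≤ K * s⁻¹ * I * (C * s) := by gcongr; exact hC j
          _ = C * K * I * (s⁻¹ * s) := by ring
          _ = C * K * I := by rw [ENNReal.inv_mul_cancel hs0 ENNReal.ofReal_ne_top, mul_one]
    _ = C * K * ∑' j, ∫⁻ z in cube (ζ j) (5 / 4 * ℓ j), ‖f z‖ₑ ^ p ∂(weightedMeasure n α) :=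
        ENNReal.tsum_mul_left
    _ ≤ C * K * (N * ∫⁻ z, ‖f z‖ₑ ^ p ∂(weightedMeasure n α)) := by
        gcongr
        exact hN _ (aemeasurable_enorm_rpow α p hf.continuousOn)
    _ = _ := by ring

lemma measurableSet_strip (k : ℤ) : MeasurableSet (strip n k) :=
  (measurableSet_le measurable_const continuous_height.measurable).inter
    (measurableSet_lt continuous_height.measurable measurable_const)

lemma pairwise_disjoint_strip : Pairwise (Function.onFun Disjoint (strip n)) := by
  have key (i j : ℤ) (hij : i < j) : Disjoint (strip n i) (strip n j) := by
    refine Set.disjoint_left.2 fun z hi hj => ?_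
    have h1 : (2 : ℝ) ^ (-(i + 1)) < 2 ^ (-j) := hi.1.trans_lt hj.2
    have := (zpow_lt_zpow_iff_right₀ (one_lt_two : (1 : ℝ) < 2)).1 h1
    omega
  intro i j hij
  rcases hij.lt_or_gt with h | h
  · exact key i j h
  · exact (key j i h).symm

lemma strip_subset (k : ℤ) : strip n k ⊆ upperHalfSpace n := fun _ hz =>
  (by positivity : (0 : ℝ) < 2 ^ (-(k + 1))).trans_le hz.1

/-- The strips are disjoint, so the `ℓ^1` sum of the strip integrals is one integral; `p ≤ q` lets
it dominate the `ℓ^(q/p)` norm. -/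
lemma herzNorm_le {𝕜 : Type*} [RCLike 𝕜] {p q : ℝ} (hp : 0 < p) (hpq : p ≤ q)
    (μ : Measure (Space n)) (f : Space n → 𝕜) :
    herzNorm p q μ f ≤ (∫⁻ z in upperHalfSpace n, ‖f z‖ₑ ^ p ∂μ) ^ (1 / p) := by
  have hq : 0 < q := hp.trans_le hpq
  rw [herzNorm]
  calc _ ≤ ((∑' k : ℤ, ∫⁻ z in strip n k, ‖f z‖ₑ ^ p ∂μ) ^ (q / p)) ^ (1 / q) := by
        gcongr
        exact ENNReal.tsum_rpow_le_rpow_tsum _ ((one_le_div hp).2 hpq)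
    _ = (∫⁻ z in ⋃ k, strip n k, ‖f z‖ₑ ^ p ∂μ) ^ (1 / p) := by
        rw [lintegral_iUnion measurableSet_strip pairwise_disjoint_strip, ← ENNReal.rpow_mul]
        congr 1
        field_simp
    _ ≤ _ := by
        gcongr
        exact Set.iUnion_subset strip_subset

theorem IsWhitneyDecomposition.bergmanEmbedsHerz (hΔ : IsWhitneyDecomposition ζ ℓ)
    (𝕜 : Type*) [RCLike 𝕜] (α : ℝ) {p q : ℝ} (hp : 0 < p) (hpq : p ≤ q)
    {μ : Measure (Space n)} {C : ℝ≥0}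
    (hC : ∀ j, μ (cube (ζ j) (ℓ j)) ≤ C * ENNReal.ofReal (ℓ j ^ ((n : ℝ) + 1 + α))) :
    BergmanEmbedsHerz n 𝕜 p q α μ := by
  obtain ⟨K, hK, h⟩ := hΔ.exists_lintegral_le 𝕜 α hp hC
  have hK' : K ^ (1 / p) ≠ ∞ := ENNReal.rpow_ne_top_of_nonneg (by positivity) hK
  have hle (f : Space n → 𝕜) (hf : f ∈ bergmanSpace n 𝕜 p α) :
      herzNorm p q μ f ≤ (K ^ (1 / p)).toNNReal * bergmanNorm p α f := by
    rw [ENNReal.coe_toNNReal hK', bergmanNorm, ← ENNReal.mul_rpow_of_nonneg _ _ (by positivity)]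
    refine (herzNorm_le hp hpq μ f).trans ?_
    gcongr
    exact h f hf.1
  exact ⟨fun f hf => ⟨hf.1, (hle f hf).trans_lt (ENNReal.mul_lt_top (by simp) hf.2)⟩, _, hle⟩

end HarmonicHerz

/-! ### Harmonic functions with poles of high order. -/

section Kelvin

open InnerProductSpace Topology

variable {E : Type*} [NormedAddCommGroup E] [InnerProductSpace ℝ E]

/-- The Kelvin transform `‖x‖ ^ (-2β) Λ(x) ^ m`, `x = z - b`, of the power of a linear form. -/
noncomputable def kelvinPow (Λ : E →L[ℝ] ℂ) (b : E) (β : ℝ) (m : ℕ) (z : E) : ℂ :=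
  (((‖z - b‖ ^ 2) ^ (-β) : ℝ) : ℂ) * Λ (z - b) ^ m

variable {Λ : E →L[ℝ] ℂ} {b : E} {β : ℝ} {m : ℕ}

lemma contDiffAt_kelvinPow {z : E} (hz : z ≠ b) : ContDiffAt ℝ 2 (kelvinPow Λ b β m) z := by
  have h : ‖z - b‖ ^ 2 ≠ 0 := by simpa [sub_eq_zero] using hz
  have h1 : ContDiffAt ℝ 2 (fun z : E => (‖z - b‖ ^ 2) ^ (-β)) z :=
    ContDiffAt.rpow_const_of_ne (by
      have : ContDiffAt ℝ 2 (fun z : E => z - b) z := by fun_prop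
      exact this.norm_sq ℝ) h
  exact (Complex.ofRealCLM.contDiff.contDiffAt.comp z h1).mul (by fun_prop)

lemma hasDerivAt_normSq_line (x v : E) :
    HasDerivAt (fun s : ℝ => ‖x + s • v‖ ^ 2) (2 * inner ℝ x v) 0 := by
  have h1 : HasDerivAt (fun s : ℝ => x + s • v) v 0 := by
    simpa using ((hasDerivAt_id (0 : ℝ)).smul_const v).const_add x
  simpa using h1.norm_sq

lemma hasDerivAt_normSq_rpow_line {x : E} (hx : x ≠ 0) (v : E) (γ : ℝ) :
    HasDerivAt (fun s : ℝ => (((‖x + s • v‖ ^ 2) ^ γ : ℝ) : ℂ))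
      (((2 * inner ℝ x v * γ * (‖x‖ ^ 2) ^ (γ - 1) : ℝ)) : ℂ) 0 := by
  have h := (hasDerivAt_normSq_line x v).rpow_const (p := γ) (Or.inl (by simpa using hx))
  simpa using h.ofReal_comp

lemma hasDerivAt_clm_pow_line (Λ : E →L[ℝ] ℂ) (x v : E) (m : ℕ) :
    HasDerivAt (fun s : ℝ => Λ (x + s • v) ^ m) (m * Λ x ^ (m - 1) * Λ v) 0 := by
  have h1 : HasDerivAt (fun s : ℝ => x + s • v) v 0 := by
    simpa using ((hasDerivAt_id (0 : ℝ)).smul_const v).const_add x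
  have h2 : HasDerivAt (fun s : ℝ => Λ (x + s • v)) (Λ v) 0 :=
    Λ.hasFDerivAt.comp_hasDerivAt 0 h1
  have h3 := h2.fun_pow m
  rwa [zero_smul, add_zero] at h3

lemma fderiv_kelvinPow_apply {z : E} (hz : z ≠ b) (v : E) :
    fderiv ℝ (kelvinPow Λ b β m) z v =
      ((2 * inner ℝ (z - b) v * (-β) * (‖z - b‖ ^ 2) ^ (-β - 1) : ℝ) : ℂ) * Λ (z - b) ^ m +
      (((‖z - b‖ ^ 2) ^ (-β) : ℝ) : ℂ) * (m * Λ (z - b) ^ (m - 1) * Λ v) := by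
  have h1 : HasDerivAt (fun s : ℝ => z + s • v) v 0 := by
    simpa using ((hasDerivAt_id (0 : ℝ)).smul_const v).const_add z
  have h2 : HasDerivAt (fun s : ℝ => kelvinPow Λ b β m (z + s • v))
      (fderiv ℝ (kelvinPow Λ b β m) z v) 0 :=
    HasFDerivAt.comp_hasDerivAt (f := fun s : ℝ => z + s • v) (l := kelvinPow Λ b β m) 0 (by
      simpa using ((contDiffAt_kelvinPow hz).differentiableAt (by norm_num)).hasFDerivAt) h1
  have h3 := (hasDerivAt_normSq_rpow_line (sub_ne_zero.2 hz) v (-β)).mul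
    (hasDerivAt_clm_pow_line Λ (z - b) v m)
  refine h2.unique ((h3.congr_of_eventuallyEq
    (Filter.Eventually.of_forall fun s => ?_)).congr_deriv ?_)
  · simp only [kelvinPow, Pi.mul_apply, sub_add_eq_add_sub]
  · simp

/-- The Laplacian needs only the diagonal second derivatives, which are one-variable derivatives
along lines. -/
lemma fderiv_fderiv_kelvinPow_apply {z : E} (hz : z ≠ b) (v : E) :
    fderiv ℝ (fderiv ℝ (kelvinPow Λ b β m)) z v v =
      ((4 * β * (β + 1) * (‖z - b‖ ^ 2) ^ (-β - 2) * inner ℝ (z - b) v ^ 2 -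
        2 * β * (‖z - b‖ ^ 2) ^ (-β - 1) * inner ℝ v v : ℝ) : ℂ) * Λ (z - b) ^ m -
      4 * β * m * (((‖z - b‖ ^ 2) ^ (-β - 1) : ℝ) : ℂ) * Λ (z - b) ^ (m - 1) *
        (inner ℝ (z - b) v * Λ v) +
      (((‖z - b‖ ^ 2) ^ (-β) : ℝ) : ℂ) * (m * (m - 1 : ℕ) * Λ (z - b) ^ (m - 1 - 1)) *
        Λ v ^ 2 := by
  have h1 : HasDerivAt (fun s : ℝ => z + s • v) v 0 := by
    simpa using ((hasDerivAt_id (0 : ℝ)).smul_const v).const_add z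
  have hd : DifferentiableAt ℝ (fderiv ℝ (kelvinPow Λ b β m)) z :=
    ((contDiffAt_kelvinPow hz).fderiv_right (m := 1) (by norm_num)).differentiableAt (by norm_num)
  have h2 : HasDerivAt (fun s : ℝ => fderiv ℝ (kelvinPow Λ b β m) (z + s • v) v)
      (fderiv ℝ (fderiv ℝ (kelvinPow Λ b β m)) z v v) 0 := by
    have := HasFDerivAt.comp_hasDerivAt (f := fun s : ℝ => z + s • v)
      (l := fderiv ℝ (kelvinPow Λ b β m)) 0 (by simpa using hd.hasFDerivAt) h1
    exact (ContinuousLinearMap.apply ℝ ℂ v).hasFDerivAt.comp_hasDerivAt 0 this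
  have hx := sub_ne_zero.2 hz
  have hin : HasDerivAt (fun s : ℝ => ((2 * inner ℝ (z - b + s • v) v * (-β) : ℝ) : ℂ))
      ((2 * inner ℝ v v * (-β) : ℝ) : ℂ) 0 := by
    have h4 : HasDerivAt (fun s : ℝ => z - b + s • v) v 0 := by
      simpa using ((hasDerivAt_id (0 : ℝ)).smul_const v).const_add (z - b)
    have h5 : HasDerivAt (fun s : ℝ => inner ℝ (z - b + s • v) v) (inner ℝ v v) 0 := by
      simpa using h4.inner ℝ (hasDerivAt_const 0 v)
    exact ((h5.const_mul 2).mul_const (-β)).ofReal_comp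
  have h3 := ((hin.mul (hasDerivAt_normSq_rpow_line hx v (-β - 1))).mul
    (hasDerivAt_clm_pow_line Λ (z - b) v m)).add
    ((hasDerivAt_normSq_rpow_line hx v (-β)).mul
      (((hasDerivAt_clm_pow_line Λ (z - b) v (m - 1)).const_mul (m : ℂ)).mul_const (Λ v)))
  have hev : ∀ᶠ s : ℝ in 𝓝 0, z + s • v ≠ b := by
    refine h1.continuousAt.eventually_ne (by simpa using hz)
  refine h2.unique ((h3.congr_of_eventuallyEq (hev.mono fun s hs => ?_)).congr_deriv ?_)
  · simp only [fderiv_kelvinPow_apply hs, Pi.mul_apply, Pi.add_apply, sub_add_eq_add_sub]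
    push_cast
    ring
  · simp only [Pi.mul_apply, zero_smul, add_zero]
    rw [show -β - 1 - 1 = -β - 2 by ring]
    push_cast
    ring

/-- The null condition on `Λ` removes the terms with `Λ (e i) ^ 2`. By homogeneity the others add up
to a multiple of `2β (2β + 2 - d - 2m)`, with `d` the dimension, and this vanishes for the given
`β`. -/
lemma harmonicAt_kelvinPow [FiniteDimensional ℝ E] {ι : Type*} [Fintype ι]
    (e : OrthonormalBasis ι ℝ E) (hΛ : ∑ i, Λ (e i) ^ 2 = 0)
    (hβ : β = m + (Fintype.card ι : ℝ) / 2 - 1) {z : E} (hz : z ≠ b) :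
    HarmonicAt (kelvinPow Λ b β m) z := by
  refine ⟨contDiffAt_kelvinPow hz, ?_⟩
  filter_upwards [isOpen_ne.mem_nhds hz] with y hy
  rw [laplacian_eq_iteratedFDeriv_orthonormalBasis _ e]
  have hN : 0 < ‖y - b‖ ^ 2 := by
    have := norm_pos_iff.2 (sub_ne_zero.2 hy)
    positivity
  have h1 : ∑ i, inner ℝ (y - b) (e i) ^ 2 = ‖y - b‖ ^ 2 := by
    rw [← e.sum_sq_norm_inner_left (y - b)]
    simp
  have h2 : ∑ i, (inner ℝ (y - b) (e i) : ℂ) * Λ (e i) = Λ (y - b) := by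
    conv_rhs => rw [← e.sum_repr (y - b), map_sum]
    exact Finset.sum_congr rfl fun i _ => by
      rw [map_smul, e.repr_apply_apply, real_inner_comm, Complex.real_smul]
  have h3 : ∑ i, inner ℝ (e i) (e i) = (Fintype.card ι : ℝ) := by simp
  simp only [iteratedFDeriv_two_apply, Matrix.cons_val_zero, Matrix.cons_val_one,
    fderiv_fderiv_kelvinPow_apply hy, Finset.sum_add_distrib, Finset.sum_sub_distrib,
    ← Finset.mul_sum, ← Finset.sum_mul, ← Complex.ofReal_sum, h1, h2, h3, hΛ, Pi.zero_apply]
  have h4 : (‖y - b‖ ^ 2) ^ (-β - 1) = (‖y - b‖ ^ 2) ^ (-β - 2) * ‖y - b‖ ^ 2 := by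
    rw [← Real.rpow_add_one hN.ne']
    ring_nf
  -- The truncated exponent `m - 1` satisfies `Λ ^ (m - 1) * Λ = Λ ^ m` only for `m ≥ 1`; for `m =
  -- 0` the term carries the factor `m = 0`.
  rcases m with _ | k
  · simp only [h4]
    subst hβ
    push_cast
    ring
  · simp only [h4, Nat.add_sub_cancel, pow_succ (Λ (y - b)) k]
    subst hβ
    push_cast
    ring

end Kelvin

/-! ### An integrable majorant and the null form. -/

lemma integrable_one_add_abs_rpow_mul_indicator {α κ : ℝ} (hα : -1 < α) (h : 1 + α < κ) :
    Integrable fun u : ℝ => (1 + |u|) ^ (-κ) * (Set.Ioi (0 : ℝ)).indicator (fun u => u ^ α) u := by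
  have hmeas : Measurable fun u : ℝ => (1 + |u|) ^ (-κ) * u ^ α := by fun_prop
  have : (fun u : ℝ => (1 + |u|) ^ (-κ) * (Set.Ioi (0 : ℝ)).indicator (fun u => u ^ α) u) =
      (Set.Ioi (0 : ℝ)).indicator fun u => (1 + |u|) ^ (-κ) * u ^ α := by
    ext u
    by_cases hu : u ∈ Set.Ioi (0 : ℝ) <;> simp [hu]
  rw [this, integrable_indicator_iff measurableSet_Ioi, ← Set.Ioc_union_Ioi_eq_Ioi zero_le_one]
  refine IntegrableOn.union ?_ ?_
  · have h1 := (intervalIntegrable_iff_integrableOn_Ioc_of_le zero_le_one).1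
      (intervalIntegral.intervalIntegrable_rpow' (a := 0) (b := 1) hα)
    refine Integrable.mono' h1 hmeas.aestronglyMeasurable ?_
    filter_upwards [ae_restrict_mem measurableSet_Ioc] with u hu
    have h0 : 0 ≤ u ^ α := Real.rpow_nonneg hu.1.le _
    rw [Real.norm_of_nonneg (by positivity)]
    exact mul_le_of_le_one_left h0 (Real.rpow_le_one_of_one_le_of_nonpos
      (by linarith [abs_nonneg u]) (by linarith))
  · have h1 := integrableOn_Ioi_rpow_of_lt (a := α - κ) (c := 1) (by linarith) one_pos
    refine Integrable.mono' h1 hmeas.aestronglyMeasurable ?_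
    filter_upwards [ae_restrict_mem measurableSet_Ioi] with u hu
    have hu0 : 0 < u := one_pos.trans hu
    have h0 : 0 ≤ u ^ α := Real.rpow_nonneg hu0.le _
    rw [Real.norm_of_nonneg (by positivity), sub_eq_neg_add, Real.rpow_add hu0]
    refine mul_le_mul_of_nonneg_right ?_ h0
    exact Real.rpow_le_rpow_of_nonpos hu0 (by linarith [le_abs_self u]) (by linarith)

namespace HarmonicHerz

open InnerProductSpace

variable {n : ℕ}

/-- An integrable product majorant for powers of the distance to a point below the half space. -/
noncomputable def productMajorant (n : ℕ) (α κ : ℝ) (z : Space n) : ℝ :=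
  (∏ i, (1 + |z i|) ^ (-κ)) * (Set.Ioi (0 : ℝ)).indicator (fun u => u ^ α) (height z)

/-- The product form reduces integrability to one variable at a time: `κ > 1` serves the horizontal
coordinates, `α > -1` and `κ > 1 + α` the height. -/
lemma integrable_productMajorant (n : ℕ) {α κ : ℝ} (hα : -1 < α) (hκ : 1 < κ) (h : 1 + α < κ) :
    Integrable (productMajorant n α κ) := by
  classical
  let g : Fin (n + 1) → ℝ → ℝ := fun i u => (1 + |u|) ^ (-κ) *
    if i = Fin.last n then (Set.Ioi (0 : ℝ)).indicator (fun u => u ^ α) u else 1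
  have hg (i) : Integrable (g i) := by
    by_cases hi : i = Fin.last n
    · simpa [g, hi] using integrable_one_add_abs_rpow_mul_indicator hα h
    · simpa [g, hi] using integrable_one_add_norm (E := ℝ) (μ := volume) (r := κ) (by simpa using hκ)
  have h1 := Integrable.fintype_prod hg
  have h2 := (EuclideanSpace.volume_preserving_symm_measurableEquiv_toLp (Fin (n + 1))).integrable_comp_of_integrable h1
  refine h2.congr (Filter.Eventually.of_forall fun z => ?_)
  simp only [g, productMajorant, Function.comp_apply, Finset.prod_mul_distrib]
  simp [height]

/-- The decay is shared equally among the `n + 1` coordinates, each satisfying `1 + |y i| ≤ 2 ‖x‖`.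
-/
lemma norm_rpow_le_prod {x : Space n} {y : Space n} (h1 : 1 ≤ ‖x‖) (h : ∀ i, |y i| ≤ ‖x‖)
    {κ : ℝ} (hκ : 0 ≤ κ) :
    ‖x‖ ^ (-(κ * (n + 1))) ≤ 2 ^ (κ * (n + 1)) * ∏ i, (1 + |y i|) ^ (-κ) := by
  have h0 : 0 < ‖x‖ := one_pos.trans_le h1
  have h2 (i) : ‖x‖ ^ (-κ) ≤ 2 ^ κ * (1 + |y i|) ^ (-κ) := by
    have h3 : (2 * ‖x‖) ^ (-κ) ≤ (1 + |y i|) ^ (-κ) :=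
      Real.rpow_le_rpow_of_nonpos (by positivity) (by linarith [h i]) (by linarith)
    rw [Real.mul_rpow zero_le_two h0.le, Real.rpow_neg zero_le_two] at h3
    rwa [← inv_mul_le_iff₀ (by positivity)]
  calc ‖x‖ ^ (-(κ * (n + 1))) = ∏ _i : Fin (n + 1), ‖x‖ ^ (-κ) := by
        rw [Finset.prod_const, ← Real.rpow_natCast, ← Real.rpow_mul h0.le]
        simp
    _ ≤ ∏ i, (2 ^ κ * (1 + |y i|) ^ (-κ)) :=
        Finset.prod_le_prod (fun _ _ => by positivity) fun i _ => h2 i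
    _ = _ := by
        rw [Finset.prod_mul_distrib, Finset.prod_const, ← Real.rpow_natCast,
          ← Real.rpow_mul zero_le_two]
        simp

/-- The complex linear form `t + i x₁` on `ℝ^{n+1}`. -/
noncomputable def planeForm (n : ℕ) : Space n →L[ℝ] ℂ :=
  Complex.ofRealCLM.comp (EuclideanSpace.proj (Fin.last n)) +
    Complex.I • Complex.ofRealCLM.comp (EuclideanSpace.proj 0)

lemma planeForm_apply (z : Space n) :
    planeForm n z = (z (Fin.last n) : ℂ) + Complex.I * (z 0 : ℂ) := by
  simp [planeForm]

/-- As `n ≥ 1`, the coordinates `0` and `Fin.last n` differ, and they contribute `i ^ 2 + 1 = 0`. -/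
lemma sum_planeForm_sq (hn : 1 ≤ n) :
    ∑ i, planeForm n (EuclideanSpace.basisFun (Fin (n + 1)) ℝ i) ^ 2 = 0 := by
  have h0 : (Fin.last n) ≠ 0 := by
    rw [ne_eq, Fin.last_eq_zero_iff]
    omega
  have h (i : Fin (n + 1)) : planeForm n (EuclideanSpace.basisFun (Fin (n + 1)) ℝ i) ^ 2 =
      (if i = Fin.last n then 1 else 0) - if i = 0 then 1 else 0 := by
    rw [planeForm_apply]
    rcases eq_or_ne i (Fin.last n) with rfl | hi
    · simp [h0, h0.symm]
    · rcases eq_or_ne i 0 with rfl | hi'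
      · simp [h0, h0.symm]
      · simp [hi, hi', hi.symm, hi'.symm]
  simp only [h]
  simp

lemma norm_planeForm_le (hn : 1 ≤ n) (z : Space n) : ‖planeForm n z‖ ≤ ‖z‖ := by
  have h0 : (Fin.last n) ≠ 0 := by
    rw [ne_eq, Fin.last_eq_zero_iff]
    omega
  rw [planeForm_apply, mul_comm, Complex.norm_add_mul_I, EuclideanSpace.norm_eq]
  refine Real.sqrt_le_sqrt ?_
  rw [← Finset.sum_pair (f := fun i => z i ^ 2) h0]
  simp only [Real.norm_eq_abs, sq_abs]
  exact Finset.sum_le_sum_of_subset_of_nonneg (Finset.subset_univ _) fun i _ _ => sq_nonneg _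

/-- Continuity of `(1 + iy) ^ m` at `y = 0`, then homogeneity: the real part cannot vanish in a
narrow cone about the vertical axis. -/
lemma exists_half_le_re_pow (m : ℕ) :
    ∃ ε : ℝ, 0 < ε ∧ ∀ t u : ℝ, 0 < t → |u| ≤ ε * t →
      t ^ m / 2 ≤ (((t : ℂ) + Complex.I * (u : ℂ)) ^ m).re := by
  have hc : ContinuousAt (fun y : ℝ => ((1 + Complex.I * (y : ℂ)) ^ m).re) 0 := by fun_prop
  have hev := hc.eventually (lt_mem_nhds (a := 1 / 2) (by simp; norm_num))
  obtain ⟨ε, hε, h⟩ := Metric.eventually_nhds_iff.1 hev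
  refine ⟨ε / 2, by positivity, fun t u ht hu => ?_⟩
  have h1 : 1 / 2 < ((1 + Complex.I * ((u / t : ℝ) : ℂ)) ^ m).re := h <| by
    rw [Real.dist_eq, sub_zero, abs_div, abs_of_pos ht, div_lt_iff₀ ht]
    nlinarith
  have h2 : (t : ℂ) + Complex.I * (u : ℂ) = (t : ℂ) * (1 + Complex.I * ((u / t : ℝ) : ℂ)) := by
    have : (t : ℂ) ≠ 0 := by exact_mod_cast ht.ne'
    push_cast
    field_simp
  rw [h2, mul_pow, ← Complex.ofReal_pow, Complex.re_ofReal_mul]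
  have : 0 < t ^ m := by positivity
  nlinarith

end HarmonicHerz

/-! ### Test functions and necessity. -/

namespace HarmonicHerz

open InnerProductSpace

variable {n : ℕ} {𝕜 : Type*} [RCLike 𝕜]

/-- The exponent for which `kelvinPow` is harmonic in dimension `n + 1`. -/
noncomputable def kelvinExp (n m : ℕ) : ℝ := m + ((n : ℝ) + 1) / 2 - 1

/-- Harmonic functions with a pole at `b` of order `m + n - 1`, normalized at the scale `s`. -/
noncomputable def testFun (𝕜 : Type*) [RCLike 𝕜] (b : Space n) (m : ℕ) (s : ℝ) (z : Space n) : 𝕜 :=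
  RCLike.ofRealCLM (K := 𝕜) (s ^ ((m : ℝ) + n - 1) *
    (kelvinPow (planeForm n) b (kelvinExp n m) m z).re)

lemma harmonicOnNhd_testFun (hn : 1 ≤ n) {b : Space n} (hb : b ∉ upperHalfSpace n) (m : ℕ)
    (s : ℝ) : HarmonicOnNhd (testFun 𝕜 b m s) (upperHalfSpace n) := by
  intro z hz
  have h : HarmonicAt (kelvinPow (planeForm n) b (kelvinExp n m) m) z :=
    harmonicAt_kelvinPow (EuclideanSpace.basisFun (Fin (n + 1)) ℝ) (sum_planeForm_sq hn)
      (by simp [kelvinExp]) (fun h => hb (h ▸ hz))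
  exact ((h.comp_CLM Complex.reCLM).const_smul (c := s ^ ((m : ℝ) + n - 1))).comp_CLM
    (RCLike.ofRealCLM (K := 𝕜))

lemma norm_kelvinPow_le (hn : 1 ≤ n) {b z : Space n} (hz : z ≠ b) (m : ℕ) :
    ‖kelvinPow (planeForm n) b (kelvinExp n m) m z‖ ≤ ‖z - b‖ ^ (-((m : ℝ) + n - 1)) := by
  have h0 : 0 < ‖z - b‖ := norm_pos_iff.2 (sub_ne_zero.2 hz)
  rw [kelvinPow, norm_mul, norm_pow, Complex.norm_real, Real.norm_of_nonneg (by positivity)]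
  calc _ ≤ (‖z - b‖ ^ 2) ^ (-kelvinExp n m) * ‖z - b‖ ^ m := by
        gcongr
        exact norm_planeForm_le hn _
    _ = _ := by
        rw [← Real.rpow_natCast, ← Real.rpow_natCast, ← Real.rpow_mul h0.le, ← Real.rpow_add h0]
        congr 1
        simp only [kelvinExp]
        push_cast
        ring

/-- The normalizing power of `s` cancels the homogeneity of the kernel, so the bound in the rescaled
variable `y` is free of `s`. -/
lemma norm_testFun_le (hn : 1 ≤ n) {p₀ y : Space n} {s Θ : ℝ} (hs : 0 < s)
    (hy : y + EuclideanSpace.single (Fin.last n) Θ ≠ 0) (m : ℕ) :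
    ‖testFun 𝕜 (p₀ - s • EuclideanSpace.single (Fin.last n) Θ) m s (p₀ + s • y)‖ ≤
      ‖y + EuclideanSpace.single (Fin.last n) Θ‖ ^ (-((m : ℝ) + n - 1)) := by
  set v := EuclideanSpace.single (Fin.last n) Θ
  have h1 : p₀ + s • y - (p₀ - s • v) = s • (y + v) := by rw [smul_add]; abel
  have h2 : p₀ + s • y ≠ p₀ - s • v := by
    rw [← sub_ne_zero, h1]
    exact smul_ne_zero hs.ne' hy
  have h3 := (Complex.abs_re_le_norm _).trans (norm_kelvinPow_le hn h2 m)
  rw [h1, norm_smul, Real.norm_of_nonneg hs.le, Real.mul_rpow hs.le (norm_nonneg _)] at h3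
  rw [testFun, RCLike.ofRealCLM_apply, RCLike.norm_ofReal, abs_mul, abs_of_pos (by positivity)]
  calc _ ≤ s ^ ((m : ℝ) + n - 1) * (s ^ (-((m : ℝ) + n - 1)) * ‖y + v‖ ^ (-((m : ℝ) + n - 1))) := by
        gcongr
    _ = _ := by
        rw [← mul_assoc, ← Real.rpow_add hs]
        simp

/-- The weighted norms of the test functions. -/
lemma lintegral_testFun_le (hn : 1 ≤ n) (α : ℝ) {p : ℝ} (hp : 0 < p) {p₀ : Space n}
    (hp₀ : height p₀ = 0) {s Θ : ℝ} (hs : 0 < s) (hΘ : 1 ≤ Θ) (m : ℕ) :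
    ∫⁻ z, ‖testFun 𝕜 (p₀ - s • EuclideanSpace.single (Fin.last n) Θ) m s z‖ₑ ^ p
        ∂(weightedMeasure n α) ≤
      ENNReal.ofReal (2 ^ (((m : ℝ) + n - 1) * p)) *
        (∫⁻ y, ENNReal.ofReal (productMajorant n α (((m : ℝ) + n - 1) * p / (n + 1)) y)) *
        ENNReal.ofReal (s ^ ((n : ℝ) + 1 + α)) := by
  set f := testFun 𝕜 (p₀ - s • EuclideanSpace.single (Fin.last n) Θ) m s with hf
  set κ := ((m : ℝ) + n - 1) * p / (n + 1) with hκ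
  have hn' : (1 : ℝ) ≤ n := by exact_mod_cast hn
  have hM : 0 ≤ (m : ℝ) + n - 1 := by linarith [m.cast_nonneg (α := ℝ)]
  have hκ0 : 0 ≤ κ := by positivity
  have hκn : κ * (n + 1) = ((m : ℝ) + n - 1) * p := by rw [hκ]; field_simp
  have hmeas : Measurable fun z : Space n => ENNReal.ofReal (height z ^ α) :=
    (continuous_height.measurable.pow_const α).ennreal_ofReal
  have hheight (y : Space n) : height (p₀ + s • y) = s * height y := by
    simp only [height] at hp₀ ⊢
    simp [hp₀]
  have hpt (y : Space n) (hy : 0 < height y) :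
      ENNReal.ofReal (height (p₀ + s • y) ^ α) * ‖f (p₀ + s • y)‖ₑ ^ p ≤
        ENNReal.ofReal (2 ^ (((m : ℝ) + n - 1) * p)) * ENNReal.ofReal (s ^ α) *
          ENNReal.ofReal (productMajorant n α κ y) := by
    -- With the pole at depth `Θ ≥ 1`, the distance to it is at least 1 and dominates every
    -- coordinate of `y`, as `norm_rpow_le_prod` requires.
    have hlast : height y + Θ ≤ ‖y + EuclideanSpace.single (Fin.last n) Θ‖ := by
      refine le_trans ?_ (PiLp.norm_apply_le (y + EuclideanSpace.single (Fin.last n) Θ) (Fin.last n))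
      simpa [height] using le_abs_self _
    have hcoord (i) : |y i| ≤ ‖y + EuclideanSpace.single (Fin.last n) Θ‖ := by
      rcases eq_or_ne i (Fin.last n) with rfl | hi
      · have : |y (Fin.last n)| = height y := abs_of_pos hy
        linarith
      · refine le_trans ?_ (PiLp.norm_apply_le (y + EuclideanSpace.single (Fin.last n) Θ) i)
        simp [hi]
    have hone : 1 ≤ ‖y + EuclideanSpace.single (Fin.last n) Θ‖ := by linarith
    have h1 := norm_testFun_le (𝕜 := 𝕜) hn (p₀ := p₀) hs
      (norm_pos_iff.1 (one_pos.trans_le hone)) m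
    have h2 := Real.rpow_le_rpow (norm_nonneg _) h1 hp.le
    rw [← Real.rpow_mul (norm_nonneg _), neg_mul, ← hκn] at h2
    have h3 := h2.trans (norm_rpow_le_prod hone hcoord hκ0)
    rw [← ofReal_norm, ENNReal.ofReal_rpow_of_nonneg (norm_nonneg _) hp.le,
      ← ENNReal.ofReal_mul (by rw [hheight]; positivity), ← ENNReal.ofReal_mul (by positivity),
      ← ENNReal.ofReal_mul (by positivity)]
    refine ENNReal.ofReal_le_ofReal ?_
    rw [hheight, Real.mul_rpow hs.le hy.le, productMajorant,
      Set.indicator_of_mem (Set.mem_Ioi.2 hy), ← hκn]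
    calc _ ≤ s ^ α * height y ^ α * (2 ^ (κ * (n + 1)) * ∏ i, (1 + |y i|) ^ (-κ)) := by
          gcongr
      _ = _ := by ring
  calc ∫⁻ z, ‖f z‖ₑ ^ p ∂(weightedMeasure n α)
      ≤ ∫⁻ z in upperHalfSpace n, ENNReal.ofReal (height z ^ α) * ‖f z‖ₑ ^ p :=
        lintegral_withDensity_le_lintegral_mul _ hmeas _
    _ = ∫⁻ z, (upperHalfSpace n).indicator
          (fun z => ENNReal.ofReal (height z ^ α) * ‖f z‖ₑ ^ p) z :=
        (lintegral_indicator (isOpen_upperHalfSpace n).measurableSet _).symm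
    _ = ENNReal.ofReal (s ^ (n + 1)) * ∫⁻ y, (upperHalfSpace n).indicator
          (fun z => ENNReal.ofReal (height z ^ α) * ‖f z‖ₑ ^ p) (p₀ + s • y) := by
        rw [lintegral_comp_add_smul _ _ hs, finrank_euclideanSpace_fin, ← mul_assoc,
          ENNReal.mul_inv_cancel (by simpa using by positivity) (by simp), one_mul]
    _ ≤ ENNReal.ofReal (s ^ (n + 1)) * ∫⁻ y, ENNReal.ofReal (2 ^ (((m : ℝ) + n - 1) * p)) *
          ENNReal.ofReal (s ^ α) * ENNReal.ofReal (productMajorant n α κ y) := by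
        gcongr with y
        by_cases hy : 0 < height y
        · have hmem : p₀ + s • y ∈ upperHalfSpace n := by
            change 0 < height _
            rw [hheight]
            positivity
          rw [Set.indicator_of_mem hmem]
          exact hpt y hy
        · have hmem : p₀ + s • y ∉ upperHalfSpace n := fun h => by
            change 0 < height _ at h
            rw [hheight] at h
            exact hy (pos_of_mul_pos_right h hs.le)
          rw [Set.indicator_of_notMem hmem]
          exact zero_le
    _ = _ := by
        rw [lintegral_const_mul' _ _ (ENNReal.mul_ne_top (by simp) (by simp)), Real.rpow_add hs,
          ENNReal.ofReal_mul (by positivity),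
          show (n : ℝ) + 1 = ((n + 1 : ℕ) : ℝ) by push_cast; rfl, Real.rpow_natCast]
        ring

/-- The test functions are bounded below on cubes whose height is comparable to their size, if the
pole is low enough. -/
lemma exists_le_norm_testFun (hn : 1 ≤ n) {m : ℕ} (hm : 1 ≤ m) {B : ℝ} (hB : 0 < B) :
    ∃ Θ : ℝ, 1 ≤ Θ ∧ ∃ δ : ℝ, 0 < δ ∧ ∀ (c : Space n) (s : ℝ), 0 < s →
      ∀ z ∈ cube c s, 0 < height z → height z ≤ B * s →
        δ ≤ ‖testFun 𝕜 (c - EuclideanSpace.single (Fin.last n) (height c) -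
          s • EuclideanSpace.single (Fin.last n) Θ) m s z‖ := by
  have h0 : (Fin.last n) ≠ 0 := by
    rw [ne_eq, Fin.last_eq_zero_iff]
    omega
  obtain ⟨ε, hε, hre⟩ := exists_half_le_re_pow m
  -- Seen from the pole, a point of the cube has horizontal offset at most `s / 2` and height at
  -- least `Θ * s`; it lies in the cone of aperture `ε` once `ε * Θ ≥ 1 / 2`.
  set Θ := max 1 (1 / (2 * ε))
  have hΘ : 1 ≤ Θ := le_max_left _ _
  have hΘε : 1 ≤ 2 * (ε * Θ) := by
    have : 1 / (2 * ε) ≤ Θ := le_max_right _ _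
    rw [div_le_iff₀ (by positivity)] at this
    linarith
  set Γ := ((n : ℝ) + 1) * (B + Θ + 1)
  have hΓ : 0 < Γ := by positivity
  set β := kelvinExp n m with hβ
  have hβ0 : 0 ≤ β := by
    have : (1 : ℝ) ≤ m := by exact_mod_cast hm
    have : (0 : ℝ) ≤ ((n : ℝ) + 1) / 2 := by positivity
    simp only [hβ, kelvinExp]
    linarith
  refine ⟨Θ, hΘ, (Γ ^ 2) ^ (-β) * (Θ ^ m / 2), by positivity, fun c s hs z hz hz0 hzB => ?_⟩
  set b := c - EuclideanSpace.single (Fin.last n) (height c) -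
    s • EuclideanSpace.single (Fin.last n) Θ with hb
  have hlast : (z - b) (Fin.last n) = height z + Θ * s := by
    simp [hb, height, mul_comm]
  have hother (i) (hi : i ≠ Fin.last n) : (z - b) i = z i - c i := by
    simp [hb, hi]
  have hpos : 0 < (z - b) (Fin.last n) := by rw [hlast]; positivity
  have hnorm0 : 0 < ‖z - b‖ :=
    hpos.trans_le ((le_abs_self _).trans (PiLp.norm_apply_le (z - b) (Fin.last n)))
  have hnorm : ‖z - b‖ ≤ Γ * s := by
    rw [mul_assoc]
    refine norm_le_mul_of_forall_abs_le (by positivity) fun i => ?_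
    rcases eq_or_ne i (Fin.last n) with rfl | hi
    · rw [abs_of_pos hpos, hlast]
      linarith
    · rw [hother i hi]
      have h1 := hz i
      have h2 : 0 < (B + Θ) * s := by positivity
      linarith
  have hre' : (Θ * s) ^ m / 2 ≤ (planeForm n (z - b) ^ m).re := by
    rw [planeForm_apply]
    refine le_trans ?_ (hre _ _ hpos ?_)
    · gcongr
      rw [hlast]
      linarith
    · rw [hother 0 h0.symm, hlast]
      have h1 := hz 0
      have h2 : 0 < ε * height z := by positivity
      nlinarith
  have hsq : (((Γ * s) ^ 2) ^ (-β)) ≤ (‖z - b‖ ^ 2) ^ (-β) :=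
    Real.rpow_le_rpow_of_nonpos (by positivity) (by gcongr) (by linarith)
  rw [testFun, RCLike.ofRealCLM_apply, RCLike.norm_ofReal, kelvinPow, Complex.re_ofReal_mul]
  refine le_trans ?_ (le_abs_self _)
  have hs1 : s ^ ((m : ℝ) + n - 1) * ((s ^ 2) ^ (-β) * s ^ m) = 1 := by
    rw [← Real.rpow_natCast s 2, ← Real.rpow_natCast s m, ← Real.rpow_mul hs.le,
      ← Real.rpow_add hs, ← Real.rpow_add hs]
    convert! Real.rpow_zero s using 2
    simp only [hβ, kelvinExp]
    push_cast
    ring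
  calc (Γ ^ 2) ^ (-β) * (Θ ^ m / 2)
      = (Γ ^ 2) ^ (-β) * (Θ ^ m / 2) * (s ^ ((m : ℝ) + n - 1) * ((s ^ 2) ^ (-β) * s ^ m)) := by
        rw [hs1, mul_one]
    _ = s ^ ((m : ℝ) + n - 1) * (((Γ * s) ^ 2) ^ (-β) * ((Θ * s) ^ m / 2)) := by
        rw [mul_pow Γ, mul_pow Θ, Real.mul_rpow (by positivity) (by positivity)]
        ring
    _ ≤ _ := by gcongr

variable {ζ : ℕ → Space n} {ℓ : ℕ → ℝ}

/-- Each Whitney cube has a test function which is bounded below on it and whose norm is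
controlled by the size of the cube. -/
lemma IsWhitneyDecomposition.exists_testFun (hΔ : IsWhitneyDecomposition ζ ℓ) (hn : 1 ≤ n)
    (𝕜 : Type*) [RCLike 𝕜] {α p : ℝ} (hα : -1 < α) (hp : 0 < p) :
    ∃ δ : ℝ≥0∞, δ ≠ 0 ∧ δ ≠ ∞ ∧ ∃ K : ℝ≥0∞, K ≠ ∞ ∧ ∀ j, ∃ f : Space n → 𝕜,
      HarmonicOnNhd f (upperHalfSpace n) ∧ (∀ z ∈ cube (ζ j) (ℓ j), δ ≤ ‖f z‖ₑ ^ p) ∧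
      ∫⁻ z, ‖f z‖ₑ ^ p ∂(weightedMeasure n α) ≤
        K * ENNReal.ofReal (ℓ j ^ ((n : ℝ) + 1 + α)) := by
  -- The order `m` is taken so large that the decay per coordinate, `(m + n - 1) * p / (n + 1)`,
  -- meets both conditions of `integrable_productMajorant`.
  obtain ⟨m, hm⟩ := exists_nat_gt (max 1 (1 + α) * ((n : ℝ) + 1) / p)
  rw [div_lt_iff₀ hp] at hm
  have hn' : (1 : ℝ) ≤ n := by exact_mod_cast hn
  have hκ : max 1 (1 + α) < ((m : ℝ) + n - 1) * p / (n + 1) := by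
    rw [lt_div_iff₀ (by positivity)]
    nlinarith
  have hm1 : 1 ≤ m := by
    rw [Nat.one_le_iff_ne_zero]
    rintro rfl
    have : 0 < max 1 (1 + α) * ((n : ℝ) + 1) := by positivity
    simp at hm
    linarith
  obtain ⟨B, hB, hheight⟩ := hΔ.exists_height_le_mul
  obtain ⟨Θ, hΘ, δ, hδ, hlow⟩ := exists_le_norm_testFun (𝕜 := 𝕜) hn hm1 hB
  refine ⟨ENNReal.ofReal (δ ^ p), by simpa using by positivity, by simp, _, ?_, fun j =>
    ⟨testFun 𝕜 (ζ j - EuclideanSpace.single (Fin.last n) (height (ζ j)) -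
      ℓ j • EuclideanSpace.single (Fin.last n) Θ) m (ℓ j), ?_, fun z hz => ?_,
      lintegral_testFun_le hn α hp ?_ (hΔ.side_pos j) hΘ m⟩⟩
  · refine ENNReal.mul_ne_top (by simp) ?_
    have := (integrable_productMajorant n hα ((le_max_left _ _).trans_lt hκ)
      ((le_max_right _ _).trans_lt hκ)).lintegral_lt_top
    exact this.ne
  · refine harmonicOnNhd_testFun hn ?_ m _
    have := hΔ.side_pos j
    simp only [upperHalfSpace, height, Set.mem_ofPred_eq, not_lt]
    simp
    positivity
  · rw [← ofReal_norm, ENNReal.ofReal_rpow_of_nonneg (norm_nonneg _) hp.le]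
    refine ENNReal.ofReal_le_ofReal (Real.rpow_le_rpow hδ.le ?_ hp.le)
    exact hlow _ _ (hΔ.side_pos j) z hz (hΔ.cube_subset j hz) (hheight j z hz)
  · simp [height]

lemma setLIntegral_strip_le_herzNorm {p q : ℝ} (hp : 0 < p) (hq : 0 < q) (μ : Measure (Space n))
    (f : Space n → 𝕜) (k : ℤ) :
    ∫⁻ z in strip n k, ‖f z‖ₑ ^ p ∂μ ≤ herzNorm p q μ f ^ p := by
  have h1 := ENNReal.le_tsum (f := fun k : ℤ => (∫⁻ z in strip n k, ‖f z‖ₑ ^ p ∂μ) ^ (q / p)) k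
  have h2 := ENNReal.rpow_le_rpow h1 (by positivity : 0 ≤ p / q)
  rw [← ENNReal.rpow_mul, show q / p * (p / q) = 1 by field_simp, ENNReal.rpow_one] at h2
  refine h2.trans_eq ?_
  rw [herzNorm, ← ENNReal.rpow_mul]
  congr 1
  field_simp

/-- The test function of a cube bounds its measure by the integral over the strips that cover it.
Each strip integral is at most the `p`-th power of the Herz norm, and the number of strips is
bounded uniformly in `j`, so the value of `q` plays no role. -/
theorem IsWhitneyDecomposition.exists_measure_cube_le (hΔ : IsWhitneyDecomposition ζ ℓ)
    (hn : 1 ≤ n) {α p q : ℝ} (hα : -1 < α) (hp : 0 < p) (hq : 0 < q) {μ : Measure (Space n)}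
    (h : BergmanEmbedsHerz n 𝕜 p q α μ) :
    ∃ C : ℝ≥0, ∀ j, μ (cube (ζ j) (ℓ j)) ≤ C * ENNReal.ofReal (ℓ j ^ ((n : ℝ) + 1 + α)) := by
  obtain ⟨-, C, hC⟩ := h
  obtain ⟨δ, hδ0, hδ, K, hK, htest⟩ := hΔ.exists_testFun hn 𝕜 hα hp
  obtain ⟨a, ha, hlow⟩ := hΔ.exists_mul_le_height
  obtain ⟨B, -, hup⟩ := hΔ.exists_height_le_mul
  obtain ⟨M, hM⟩ := exists_zpow_finset (n := n) (b := B) ha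
  have hfin : δ⁻¹ * (M * (C ^ p * K)) ≠ ∞ :=
    ENNReal.mul_ne_top (by simpa using hδ0) (ENNReal.mul_ne_top (by simp)
      (ENNReal.mul_ne_top (ENNReal.rpow_ne_top_of_nonneg hp.le (by simp)) hK))
  refine ⟨(δ⁻¹ * (M * (C ^ p * K))).toNNReal, fun j => ?_⟩
  rw [ENNReal.coe_toNNReal hfin]
  obtain ⟨f, hf, hfδ, hfK⟩ := htest j
  obtain ⟨S, hS, hcover⟩ := hM (ℓ j) (hΔ.side_pos j)
  set s := ENNReal.ofReal (ℓ j ^ ((n : ℝ) + 1 + α))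
  have hmem : f ∈ bergmanSpace n 𝕜 p α :=
    ⟨hf, ENNReal.rpow_lt_top_of_nonneg (by positivity)
      (hfK.trans_lt (ENNReal.mul_lt_top hK.lt_top (by simp [s]))).ne⟩
  have hherz : herzNorm p q μ f ^ p ≤ C ^ p * (K * s) := by
    refine (ENNReal.rpow_le_rpow (hC f hmem) hp.le).trans ?_
    rw [ENNReal.mul_rpow_of_nonneg _ _ hp.le, bergmanNorm, ← ENNReal.rpow_mul,
      one_div_mul_cancel hp.ne', ENNReal.rpow_one]
    gcongr
  have hmain : δ * μ (cube (ζ j) (ℓ j)) ≤ M * (C ^ p * K) * s := by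
    calc δ * μ (cube (ζ j) (ℓ j)) = ∫⁻ z in cube (ζ j) (ℓ j), δ ∂μ := (setLIntegral_const _ _).symm
      _ ≤ ∫⁻ z in cube (ζ j) (ℓ j), ‖f z‖ₑ ^ p ∂μ :=
          setLIntegral_mono' (isClosed_cube _ _).measurableSet hfδ
      _ ≤ ∫⁻ z in ⋃ k ∈ S, strip n k, ‖f z‖ₑ ^ p ∂μ := by
          refine lintegral_mono_set fun z hz => ?_
          simpa using hcover z (hlow j z hz) (hup j z hz)
      _ = ∑ k ∈ S, ∫⁻ z in strip n k, ‖f z‖ₑ ^ p ∂μ :=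
          lintegral_biUnion_finset (fun k _ l _ hkl => pairwise_disjoint_strip hkl)
            (fun k _ => measurableSet_strip k) _
      _ ≤ ∑ _k ∈ S, C ^ p * (K * s) := Finset.sum_le_sum fun k _ =>
          (setLIntegral_strip_le_herzNorm hp hq μ f k).trans hherz
      _ = S.card * (C ^ p * (K * s)) := by rw [Finset.sum_const, nsmul_eq_mul]
      _ ≤ M * (C ^ p * (K * s)) := by gcongr
      _ = _ := by ring
  rw [mul_assoc, ← ENNReal.div_eq_inv_mul, ENNReal.le_div_iff_mul_le (Or.inl hδ0) (Or.inl hδ),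
    mul_comm]
  exact hmain

end HarmonicHerz

theorem theorem8 {𝕜 : Type*} [RCLike 𝕜] (n : ℕ) (hn : 1 ≤ n)
    (ζ : ℕ → HarmonicHerz.Space n) (ℓ : ℕ → ℝ)
    (hΔ : HarmonicHerz.IsWhitneyDecomposition ζ ℓ)
    (α p q : ℝ) (hα : -1 < α) (hp : 0 < p) (hpq : p ≤ q)
    (μ : Measure (HarmonicHerz.Space n)) (hμ : μ (HarmonicHerz.upperHalfSpace n)ᶜ = 0) :
    HarmonicHerz.BergmanEmbedsHerz n 𝕜 p q α μ ↔
      ∃ C : ℝ≥0, ∀ j, μ (HarmonicHerz.cube (ζ j) (ℓ j)) ≤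
        C * volume (HarmonicHerz.cube (ζ j) (ℓ j)) ^ (1 + α / ((n : ℝ) + 1)) := by
  simp_rw [fun j => HarmonicHerz.volume_cube_rpow (ζ j) (hΔ.side_pos j) α]
  exact ⟨hΔ.exists_measure_cube_le hn hα hp (hp.trans_le hpq),
    fun ⟨_, hC⟩ => hΔ.bergmanEmbedsHerz 𝕜 α hp hpq hC⟩
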